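/- An overpartition of $n\ge 0$ is a partition of $n$ in which the first occurrence of each part size may be overlined (the empty overpartition is the only one of $0$). For an odd integer $t\ge 3$ let $\overline{S}_t(n)$ be the number of $t$-Schur overpartitions of $n$, that is, overpartitions of $n$ each of whose parts is congruent modulo $2t$ to an element of $\{1,3,5,\dots,2t-1\}\setminus\{t\}$. Let $f_k=\prod_{m\ge 1}(1-q^{km})$, a formal power series in $q$ with integer coefficients. Then, as identities in $\mathbb{Z}[[q]]$, \begin{align*} \sum_{n\ge 0}\overline{S}_9(6n)\,q^n &= 1+12q\,\frac{f_2f_6^5}{f_1^5f_3},\\ \sum_{n\ge 0}\overline{S}_9(6n+1)\,q^n &= 2\,\frac{f_2^6f_3^4}{f_1^8f_6^2},\\ \sum_{n\ge 0}\overline{S}_9(6n+2)\,q^n &= \frac{f_2^3f_3^5}{f_1^7f_6}+\frac{f_1f_6^3}{f_2f_3^3}+16q\,\frac{f_6^8}{f_1^4f_3^4},\\ \sum_{n\ge 0}\overline{S}_9(6n+3)\,q^n &= 4\,\frac{f_2^5f_3f_6}{f_1^7},\\ \sum_{n\ge 0}\overline{S}_9(6n+4)\,q^n &= 6\,\frac{f_2^2f_3^2f_6^2}{f_1^6},\\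 \sum_{n\ge 0}\overline{S}_9(6n+5)\,q^n &= 8\,\frac{f_2^4f_6^4}{f_1^6f_3^2}. \end{align*} Moreover, for all $n\ge 0$, $$\overline{S}_9(6n+3)\equiv 0 \pmod 4,\quad \overline{S}_9(6n+4)\equiv 0 \pmod 6,\quad \overline{S}_9(6n+5)\equiv 0 \pmod 8,\quad \overline{S}_9(6n+6)\equiv 0 \pmod{12}.$$ -/

import Mathlib

namespace SchurOverpartition

open PowerSeries

/-- The overpartitions of `n`: a partition of `n` together with the set of those part sizes whose
first occurrence is overlined (any set of sizes that occur as parts). -/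
def overpartitions (n : ℕ) : Finset (Σ _ : n.Partition, Finset ℕ) :=
  Finset.univ.sigma fun p => p.parts.toFinset.powerset

/-- The set `I(t) = {1, 3, 5, …, 2t - 1} \ {t}` of residues modulo `2t`. -/
def residues (t : ℕ) : Finset ℕ :=
  ((Finset.range (2 * t)).filter fun i => Odd i) \ {t}

/-- The `t`-Schur overpartitions of `n`: the overpartitions of `n` all of whose parts are congruent
modulo `2t` to an element of `I(t)`. -/
def schurOverpartitions (t n : ℕ) : Finset (Σ _ : n.Partition, Finset ℕ) :=
  (overpartitions n).filter fun o =>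
    ∀ a ∈ o.1.parts, ∃ i ∈ residues t, a ≡ i [MOD 2 * t]

/-- The number of `t`-Schur overpartitions of `n`. -/
def numSchur (t n : ℕ) : ℕ := (schurOverpartitions t n).card

section
open scoped PowerSeries.WithPiTopology

/-- `f_k = (q^k; q^k)_∞ = ∏_{m ≥ 1} (1 - q^{km})`, as a formal power series in `q = X` over `ℤ`
(infinite product for coefficientwise convergence). -/
noncomputable def f (k : ℕ) : ℤ⟦X⟧ := ∏' m : ℕ, (1 - X ^ (k * (m + 1)))

/-- The infinite product defining `f k` converges. -/
theorem multipliable_f {k : ℕ} (hk : 0 < k) :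
    Multipliable fun m : ℕ => (1 - X ^ (k * (m + 1)) : ℤ⟦X⟧) := by
  simp_rw [sub_eq_add_neg]
  apply WithPiTopology.multipliable_one_add_of_tendsto_order_atTop_nhds_top
  refine ENat.tendsto_nhds_top_iff_natCast_lt.mpr fun n =>
    Filter.eventually_atTop.mpr ⟨n, fun m hm => ?_⟩
  rw [order_neg, order_X_pow]
  norm_cast
  nlinarith

theorem constantCoeff_f {k : ℕ} (hk : 0 < k) : constantCoeff (f k) = 1 := by
  rw [f, (multipliable_f hk).map_tprod _ (WithPiTopology.continuous_constantCoeff ℤ)]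
  have h : ∀ m : ℕ, constantCoeff (1 - X ^ (k * (m + 1)) : ℤ⟦X⟧) = 1 := fun m => by
    simp [hk.ne']
  simp [h]

/-- `f k` is invertible, so that dividing by it makes sense in `ℤ⟦X⟧`. -/
theorem isUnit_f {k : ℕ} (hk : 0 < k) : IsUnit (f k) := by
  rw [isUnit_iff_constantCoeff, constantCoeff_f hk]
  exact isUnit_one

end

/-- The quotient `a / b` of formal power series over `ℤ`, for invertible `b`: the product of `a`
with the multiplicative inverse of `b`. -/
noncomputable def quot (a b : ℤ⟦X⟧) : ℤ⟦X⟧ := a * Ring.inverse b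

theorem quot_mul_cancel (a : ℤ⟦X⟧) {b : ℤ⟦X⟧} (hb : IsUnit b) : quot a b * b = a := by
  rw [quot, mul_assoc, Ring.inverse_mul_cancel b hb, mul_one]

end SchurOverpartition

/-! Write φ(-q) = ∑ (-1)^n q^(n²) = f₁²/f₂ and Ω(-q) = ∑ (-1)^n q^(3n²+2n), which are `theta 1 0`
and `theta 3 2`. Each admissible odd part m contributes (1+q^m)/(1-q^m), so the generating function
is φ(q)φ(-q¹⁸) / (φ(-q²)φ(q⁹)).

Put w(q) = Ω(-q)/φ(-q³) (`thetaRatio`). Splitting the sum over n modulo 3 gives φ(-q) = φ(-q⁹)(1 -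
2q w(q³)), hence the generating function is (1 + 2q w(-q³)) / (1 - 2q² w(q⁶)). A 2-dissection
(`rescale_thetaRatio`) gives w(-q) = a(q²) + q w(q²)² with a = `evenPart`. With b = w(q⁶) and a =
a(q⁶), the quotient becomes (1 + 2qa + 2q⁴b²) / (1 - 2q²b).

Multiplying numerator and denominator by 1 + 2q²b + 4q⁴b² turns the denominator into 1 - 8q⁶b³, a
series in q⁶. By `theta_cubic`, 1 - 8q w³ = φ(-q)⁴/φ(-q³)⁴, so its inverse (`invCubic`) is an
explicit eta quotient. Sorting powers of q modulo 6 gives the six identities, and the congruences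
are read off from their constant factors.

The product forms of the theta series come from the Jacobi triple product, obtained as a limit of
the q-binomial theorem. -/

namespace SchurOverpartition

open PowerSeries Filter Topology
open scoped PowerSeries.WithPiTopology

/-! ### Gaussian binomials and the q-binomial theorem -/

/-- The Gaussian binomial coefficient at `Q`. -/
def qBinom {R : Type*} [CommRing R] (Q : R) : ℕ → ℕ → R
  | _, 0 => 1
  | 0, _ + 1 => 0
  | n + 1, k + 1 => qBinom Q n k + Q ^ (k + 1) * qBinom Q n (k + 1)

section qBinom
variable {R : Type*} [CommRing R] (Q : R)

theorem qBinom_zero_right (n : ℕ) : qBinom Q n 0 = 1 := by cases n <;> rfl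

theorem qBinom_succ_succ (n k : ℕ) :
    qBinom Q (n + 1) (k + 1) = qBinom Q n k + Q ^ (k + 1) * qBinom Q n (k + 1) := rfl

theorem qBinom_eq_zero {n k : ℕ} (h : n < k) : qBinom Q n k = 0 := by
  induction n generalizing k with
  | zero => obtain ⟨k, rfl⟩ := Nat.exists_eq_add_one_of_ne_zero h.ne'; rfl
  | succ n ih =>
    obtain ⟨k, rfl⟩ := Nat.exists_eq_add_one_of_ne_zero (Nat.ne_zero_of_lt h)
    rw [qBinom_succ_succ, ih (by omega), ih (by omega)]; ring

/-- The `q`-binomial theorem. -/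
theorem prod_add_mul_pow (x y : R) (n : ℕ) :
    ∏ k ∈ Finset.range n, (y + x * Q ^ k) =
      ∑ j ∈ Finset.range (n + 1), Q ^ j.choose 2 * qBinom Q n j * x ^ j * y ^ (n - j) := by
  induction n generalizing x with
  | zero => simp [qBinom_zero_right]
  | succ n ih =>
    have h : ∀ k, y + x * Q ^ (k + 1) = y + (x * Q) * Q ^ k := fun k => by ring
    -- Removing the factor k = 0 leaves the product of length n at x * Q, which is why the induction
    -- keeps x general.
    rw [Finset.prod_range_succ']
    simp_rw [h]
    rw [ih, Finset.sum_range_succ' _ (n + 1)]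
    simp only [pow_zero, mul_one, mul_add]
    have e1 : ∀ j ∈ Finset.range (n + 1), Q ^ (j + 1).choose 2 * qBinom Q (n + 1) (j + 1) *
        x ^ (j + 1) * y ^ (n + 1 - (j + 1)) =
        Q ^ j.choose 2 * qBinom Q n j * (x * Q) ^ j * y ^ (n - j) * x +
        Q ^ (j + 1).choose 2 * qBinom Q n (j + 1) * (x * Q) ^ (j + 1) * y ^ (n - j) := by
      intro j _
      rw [qBinom_succ_succ, Nat.add_sub_add_right, Nat.choose_succ_succ' j 1, Nat.choose_one_right]
      ring
    rw [Finset.sum_congr rfl e1, Finset.sum_add_distrib, ← Finset.sum_mul]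
    rw [Finset.sum_range_succ' _ n, Finset.sum_range_succ _ n, qBinom_eq_zero Q (Nat.lt_succ_self n)]
    simp only [qBinom_zero_right, Nat.choose_zero_succ, pow_zero, Nat.sub_zero, mul_one, one_mul,
      mul_zero, zero_mul, add_zero, add_mul, Finset.sum_mul]
    have e2 : ∀ j ∈ Finset.range n, Q ^ (j + 1).choose 2 * qBinom Q n (j + 1) * (x * Q) ^ (j + 1) *
        y ^ (n - (j + 1)) * y =
        Q ^ (j + 1).choose 2 * qBinom Q n (j + 1) * (x * Q) ^ (j + 1) * y ^ (n - j) := by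
      intro j hj
      have : n - j = n - (j + 1) + 1 := by have := Finset.mem_range.mp hj; omega
      rw [this]; ring
    rw [Finset.sum_congr rfl e2]
    ring

/-- The q-factorial formula with denominators cleared, so that it holds in any commutative ring. It
follows from the Pascal rule by double induction. -/
theorem qBinom_mul_prod_mul_prod (m j : ℕ) :
    qBinom Q (m + j) j * (∏ i ∈ Finset.range j, (1 - Q ^ (i + 1))) *
      (∏ i ∈ Finset.range m, (1 - Q ^ (i + 1))) = ∏ i ∈ Finset.range (m + j), (1 - Q ^ (i + 1)) := by
  induction m generalizing j with
  | zero =>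
    induction j with
    | zero => simp [qBinom_zero_right]
    | succ j ih =>
      simp only [Finset.range_zero, Finset.prod_empty, mul_one, zero_add] at ih ⊢
      rw [qBinom_succ_succ, qBinom_eq_zero Q (Nat.lt_succ_self j), Finset.prod_range_succ]
      linear_combination (1 - Q ^ (j + 1)) * ih
  | succ m ihm =>
    induction j with
    | zero => simp [qBinom_zero_right]
    | succ j ih =>
      have h1 := ihm (j + 1)
      rw [show m + (j + 1) = m + 1 + j by ring] at h1
      rw [show m + 1 + (j + 1) = (m + 1 + j) + 1 by ring, qBinom_succ_succ,
        Finset.prod_range_succ _ (m + 1 + j)]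
      calc _ = (qBinom Q (m + 1 + j) j * (∏ i ∈ Finset.range j, (1 - Q ^ (i + 1))) *
                (∏ i ∈ Finset.range (m + 1), (1 - Q ^ (i + 1)))) * (1 - Q ^ (j + 1)) +
              Q ^ (j + 1) * (qBinom Q (m + 1 + j) (j + 1) *
                (∏ i ∈ Finset.range (j + 1), (1 - Q ^ (i + 1))) *
                (∏ i ∈ Finset.range m, (1 - Q ^ (i + 1)))) * (1 - Q ^ (m + 1)) := by
              rw [Finset.prod_range_succ _ j, Finset.prod_range_succ _ m]; ring
        _ = _ := by rw [ih, h1]; ring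

end qBinom

/-! ### Truncations of the infinite products -/

/-- The partial products of `f k`. -/
noncomputable def F (k n : ℕ) : ℤ⟦X⟧ := ∏ m ∈ Finset.range n, (1 - X ^ (k * (m + 1)))

theorem F_zero (k : ℕ) : F k 0 = 1 := rfl

theorem F_succ (k n : ℕ) : F k (n + 1) = F k n * (1 - X ^ (k * (n + 1))) :=
  Finset.prod_range_succ _ _

theorem tendsto_F {k : ℕ} (hk : 0 < k) : Tendsto (F k) atTop (𝓝 (f k)) :=
  (multipliable_f hk).hasProd.tendsto_prod_nat

theorem X_pow_dvd_F_sub_F {k : ℕ} (hk : 0 < k) (n i : ℕ) :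
    (X ^ n : ℤ⟦X⟧) ∣ F k (n + i) - F k n := by
  induction i with
  | zero => simp
  | succ i ih =>
    rw [← add_assoc, F_succ]
    have h : (X ^ n : ℤ⟦X⟧) ∣ X ^ (k * (n + i + 1)) := pow_dvd_pow _ (by nlinarith)
    have := dvd_sub ih (h.mul_left (F k (n + i)))
    convert this using 1
    ring

theorem X_pow_dvd_f_sub_F {k : ℕ} (hk : 0 < k) (n : ℕ) : (X ^ n : ℤ⟦X⟧) ∣ f k - F k n := by
  rw [X_pow_dvd_iff]
  intro d hd
  have h1 := (WithPiTopology.tendsto_iff_coeff_tendsto ℤ _ _ _).mp (tendsto_F hk) d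
  have h2 : Tendsto (fun i => coeff d (F k i)) atTop (𝓝 (coeff d (F k n))) := by
    refine tendsto_atTop_of_eventually_const (i₀ := n) fun i hi => ?_
    obtain ⟨i, rfl⟩ := Nat.exists_eq_add_of_le hi
    have := (X_pow_dvd_iff.mp (X_pow_dvd_F_sub_F hk n i)) d hd
    rwa [map_sub, sub_eq_zero] at this
  rw [map_sub, tendsto_nhds_unique h1 h2, sub_self]

/-- Modulo X^d the three partial products in the q-factorial formula all equal `f k`, which stays a
unit in the quotient, so one copy of it cancels. -/
theorem X_pow_dvd_f_mul_qBinom_sub_one {k : ℕ} (hk : 0 < k) {d m j : ℕ} (hm : d ≤ m) (hj : d ≤ j) :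
    (X ^ d : ℤ⟦X⟧) ∣ f k * qBinom (X ^ k) (m + j) j - 1 := by
  set π := Ideal.Quotient.mk (Ideal.span {(X ^ d : ℤ⟦X⟧)}) with hπ
  have key : ∀ n, d ≤ n → π (F k n) = π (f k) := fun n hn => by
    rw [eq_comm, hπ, Ideal.Quotient.eq, Ideal.mem_span_singleton]
    exact (pow_dvd_pow _ hn).trans (X_pow_dvd_f_sub_F hk n)
  have h := congrArg π (qBinom_mul_prod_mul_prod (X ^ k : ℤ⟦X⟧) m j)
  have e : ∀ n, ∏ i ∈ Finset.range n, (1 - ((X : ℤ⟦X⟧) ^ k) ^ (i + 1)) = F k n := fun n => by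
    simp only [F, pow_mul]
  rw [e, e, e, map_mul, map_mul, key _ hm, key _ hj, key _ (by omega)] at h
  have hu : IsUnit (π (f k)) := (isUnit_f hk).map π
  rw [← Ideal.mem_span_singleton, ← Ideal.Quotient.eq, map_one, map_mul]
  refine hu.mul_left_cancel ?_
  rw [mul_one]
  linear_combination h

/-! ### Theta series and the Jacobi triple product -/

/-- The term `(-1)^n X^(a n² + b n)` of `theta a b`. -/
noncomputable def thetaTerm (a b : ℕ) (n : ℤ) : ℤ⟦X⟧ :=
  monomial (a * n ^ 2 + b * n).toNat (n.negOnePow : ℤ)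

/-- The theta series, the sum over `n ∈ ℤ` of `(-1)^n X^(a n² + b n)`. -/
noncomputable def theta (a b : ℕ) : ℤ⟦X⟧ := ∑' n : ℤ, thetaTerm a b n

/-- This bound makes the `toNat` in `thetaTerm` harmless and lets only finitely many n contribute to
each coefficient. -/
theorem abs_le_quadratic {a b : ℕ} (h : b < a) (n : ℤ) : |n| ≤ a * n ^ 2 + b * n := by
  have ha : (b : ℤ) + 1 ≤ a := by exact_mod_cast h
  have hb : (0 : ℤ) ≤ b := by positivity
  have h1 : |n| ≤ n ^ 2 := by
    rcases eq_or_ne n 0 with rfl | h0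
    · simp
    · have := Int.one_le_abs h0
      rw [← sq_abs]; nlinarith
  have h2 : -(b * n) ≤ b * |n| := by
    have := neg_abs_le n
    nlinarith
  nlinarith

theorem coe_toNat_quadratic {a b : ℕ} (h : b < a) (n : ℤ) :
    (((a * n ^ 2 + b * n : ℤ).toNat : ℕ) : ℤ) = a * n ^ 2 + b * n :=
  Int.toNat_of_nonneg ((abs_nonneg n).trans (abs_le_quadratic h n))

theorem abs_le_toNat_quadratic {a b : ℕ} (h : b < a) (n : ℤ) :
    n.natAbs ≤ (a * n ^ 2 + b * n : ℤ).toNat := by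
  zify
  rw [coe_toNat_quadratic h]
  exact abs_le_quadratic h n

theorem coeff_thetaTerm_eq_zero {a b d : ℕ} (h : b < a) {n : ℤ} (hn : d < n.natAbs) :
    coeff d (thetaTerm a b n) = 0 := by
  rw [thetaTerm, coeff_monomial, if_neg]
  have := abs_le_toNat_quadratic h n
  omega

theorem hasSum_theta {a b : ℕ} (h : b < a) : HasSum (thetaTerm a b) (theta a b) := by
  refine Summable.hasSum ((WithPiTopology.summable_iff_summable_coeff _).mpr fun d => ?_)
  refine summable_of_hasFiniteSupport ((Set.finite_Icc (-(d : ℤ)) d).subset fun n hn => ?_)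
  by_contra hn'
  refine hn (coeff_thetaTerm_eq_zero h ?_)
  simp only [Set.mem_Icc] at hn'
  omega

theorem coeff_theta {a b d : ℕ} (h : b < a) {s : Finset ℤ} (hs : Finset.Icc (-(d : ℤ)) d ⊆ s) :
    coeff d (theta a b) = ∑ n ∈ s, coeff d (thetaTerm a b n) := by
  refine ((WithPiTopology.hasSum_iff_hasSum_coeff _).mp (hasSum_theta h) d).unique
    (hasSum_sum_of_ne_finset_zero fun n hn => coeff_thetaTerm_eq_zero h ?_)
  have : ¬(-(d : ℤ) ≤ n ∧ n ≤ d) := fun h' => hn (hs (Finset.mem_Icc.mpr h'))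
  omega

theorem two_mul_choose_two (n : ℕ) : (2 * (n.choose 2 : ℕ) : ℤ) = n * (n - 1) := by
  induction n with
  | zero => simp
  | succ n ih =>
    rw [Nat.choose_succ_succ' n 1, Nat.choose_one_right]
    push_cast
    linarith

theorem prod_range_neg_X_pow (a b n : ℕ) :
    ∏ k ∈ Finset.range n, (-(X : ℤ⟦X⟧) ^ (b + 2 * a * k)) =
      (-1) ^ n * X ^ (b * n + 2 * a * n.choose 2) := by
  induction n with
  | zero => simp
  | succ n ih =>
    rw [Finset.prod_range_succ, ih, Nat.choose_succ_succ' n 1, Nat.choose_one_right]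
    ring

/-- The finite form of the Jacobi triple product. -/
theorem finite_jacobi {a b : ℕ} (h : b < a) (N : ℕ) :
    (∏ k ∈ Finset.range N, (1 - (X : ℤ⟦X⟧) ^ (a * (2 * k + 1) - b))) *
      (∏ k ∈ Finset.range N, (1 - X ^ (a * (2 * k + 1) + b))) =
    ∑ j ∈ Finset.range (N + N + 1),
      thetaTerm a b (j - N) * qBinom (X ^ (2 * a)) (N + N) j := by
  rcases N with _ | M
  · simp [qBinom_zero_right, thetaTerm]
  set N := M + 1 with hN
  -- The q-binomial theorem is used with 2N factors y + x Q^k, where Q = X^(2a), x = -X^b, y =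
  -- X^(a(2N-1)). The lower-order monomial is x Q^k for k < N and y for k ≥ N; `P` is the product of
  -- these monomials.
  set P : ℤ⟦X⟧ := (-1) ^ N * X ^ (b * N + 2 * a * N.choose 2) * (X ^ (a * (2 * M + 1))) ^ N with hP
  have hP0 : P ≠ 0 := mul_ne_zero (mul_ne_zero (pow_ne_zero _ (by simp))
    (pow_ne_zero _ X_ne_zero)) (pow_ne_zero _ (pow_ne_zero _ X_ne_zero))
  refine mul_left_cancel₀ hP0 ?_
  have key := prod_add_mul_pow ((X : ℤ⟦X⟧) ^ (2 * a)) (-X ^ b) (X ^ (a * (2 * M + 1))) (N + N)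
  rw [Finset.prod_range_add] at key
  have e1 : ∏ k ∈ Finset.range N, ((X : ℤ⟦X⟧) ^ (a * (2 * M + 1)) + -X ^ b * (X ^ (2 * a)) ^ k) =
      (-1) ^ N * X ^ (b * N + 2 * a * N.choose 2) *
        ∏ k ∈ Finset.range N, (1 - (X : ℤ⟦X⟧) ^ (a * (2 * k + 1) - b)) := by
    rw [← prod_range_neg_X_pow,
      ← Finset.prod_range_reflect (fun k => 1 - (X : ℤ⟦X⟧) ^ (a * (2 * k + 1) - b)),
      ← Finset.prod_mul_distrib]
    refine Finset.prod_congr rfl fun k hk => ?_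
    have hk' : k ≤ M := by rw [Finset.mem_range] at hk; omega
    obtain ⟨r, hr⟩ := Nat.exists_eq_add_of_le hk'
    have e : a * (2 * M + 1) = (b + 2 * a * k) + (a * (2 * (N - 1 - k) + 1) - b) := by
      have h1 : N - 1 - k = r := by omega
      have h2 : b ≤ a * (2 * r + 1) := by nlinarith
      rw [h1, hr]
      zify [h2]
      ring
    rw [e, pow_add]
    ring
  have e2 : ∏ k ∈ Finset.range N,
        ((X : ℤ⟦X⟧) ^ (a * (2 * M + 1)) + -X ^ b * (X ^ (2 * a)) ^ (N + k)) =
      (X ^ (a * (2 * M + 1))) ^ N *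
        ∏ k ∈ Finset.range N, (1 - (X : ℤ⟦X⟧) ^ (a * (2 * k + 1) + b)) := by
    rw [← Finset.card_range N, ← Finset.prod_const, Finset.card_range, ← Finset.prod_mul_distrib]
    refine Finset.prod_congr rfl fun k _ => ?_
    rw [hN]; ring
  rw [e1, e2] at key
  calc _ = _ := by rw [hP]; ring
    _ = _ := key
    _ = _ := by
      rw [Finset.mul_sum]
      refine Finset.sum_congr rfl fun j hj => ?_
      have hj' : j ≤ N + N := by rw [Finset.mem_range] at hj; omega
      have hs : ((-1 : ℤ) ^ j) = (-1) ^ N * (((j : ℤ) - N).negOnePow : ℤ) := by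
        rw [Int.negOnePow_sub, Units.val_mul, Int.coe_negOnePow_natCast, Int.coe_negOnePow_natCast,
          mul_left_comm, ← mul_pow]
        simp
      have he : 2 * a * j.choose 2 + b * j + a * (2 * M + 1) * (N + N - j) =
          (b * N + 2 * a * N.choose 2) + a * (2 * M + 1) * N +
            (a * ((j : ℤ) - N) ^ 2 + b * ((j : ℤ) - N)).toNat := by
        zify [hj']
        rw [coe_toNat_quadratic h]
        have h1 := two_mul_choose_two j
        have h2 := two_mul_choose_two N
        have h3 : (N : ℤ) = M + 1 := by rw [hN]; push_cast; ring
        rw [h3] at h2 ⊢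
        linear_combination (a : ℤ) * h1 - (a : ℤ) * h2
      have hm : ∀ (n : ℕ) (c : ℤ), monomial n c = C c * (X : ℤ⟦X⟧) ^ n := fun n c => by
        rw [X_pow_eq, ← smul_eq_C_mul, ← map_smul, smul_eq_mul, mul_one]
      rw [thetaTerm, hm, hP]
      have hC : ((-1 : ℤ⟦X⟧) ^ j) = (-1) ^ N * C (((j : ℤ) - N).negOnePow : ℤ) := by
        have := congrArg (C (R := ℤ)) hs
        simpa using this
      rw [neg_pow (X ^ b) j, hC, ← pow_mul, ← pow_mul, ← pow_mul, ← pow_mul]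
      calc _ = (-1) ^ N * C (((j : ℤ) - N).negOnePow : ℤ) * qBinom (X ^ (2 * a)) (N + N) j *
            X ^ (2 * a * j.choose 2 + b * j + a * (2 * M + 1) * (N + N - j)) := by ring
        _ = _ := by rw [he]; ring

/-- The Jacobi triple product. -/
theorem tendsto_jacobi {a b : ℕ} (h : b < a) :
    Tendsto (fun N => F (2 * a) N *
      ((∏ k ∈ Finset.range N, (1 - (X : ℤ⟦X⟧) ^ (a * (2 * k + 1) - b))) *
      (∏ k ∈ Finset.range N, (1 - X ^ (a * (2 * k + 1) + b))))) atTop (𝓝 (theta a b)) := by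
  have h2a : 0 < 2 * a := by omega
  rw [WithPiTopology.tendsto_iff_coeff_tendsto]
  intro d
  -- Only |j - N| ≤ d matters for coefficient d. Then j and 2N - j are at least N - d ≥ d + 1, as
  -- needed for the Gaussian binomial to be replaced by 1 / f (2a) modulo X^(d+1).
  refine tendsto_atTop_of_eventually_const (i₀ := 2 * d + 1) fun N hN => ?_
  have e1 : coeff d (F (2 * a) N *
      ((∏ k ∈ Finset.range N, (1 - (X : ℤ⟦X⟧) ^ (a * (2 * k + 1) - b))) *
      (∏ k ∈ Finset.range N, (1 - X ^ (a * (2 * k + 1) + b))))) =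
      coeff d (f (2 * a) * ∑ j ∈ Finset.range (N + N + 1),
        thetaTerm a b (j - N) * qBinom (X ^ (2 * a)) (N + N) j) := by
    rw [finite_jacobi h, eq_comm, ← sub_eq_zero, ← map_sub, ← sub_mul]
    exact X_pow_dvd_iff.mp ((X_pow_dvd_f_sub_F h2a N).mul_right _) d (by omega)
  rw [e1, Finset.mul_sum, map_sum]
  have hs : Finset.Icc (-(d : ℤ)) d ⊆
      (Finset.range (N + N + 1)).image (fun j : ℕ => (j : ℤ) - N) := fun n hn => by
    rw [Finset.mem_Icc] at hn
    rw [Finset.mem_image]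
    exact ⟨(n + N).toNat, by rw [Finset.mem_range]; omega, by omega⟩
  rw [coeff_theta h hs, Finset.sum_image fun i _ j _ hij => by simpa using hij]
  refine Finset.sum_congr rfl fun j hj => ?_
  rw [Finset.mem_range] at hj
  rw [← sub_eq_zero, ← map_sub]
  by_cases hjd : d < ((j : ℤ) - N).natAbs
  · rw [show f (2 * a) * (thetaTerm a b (j - N) * qBinom (X ^ (2 * a)) (N + N) j) -
        thetaTerm a b (j - N) =
        thetaTerm a b (j - N) * (f (2 * a) * qBinom (X ^ (2 * a)) (N + N) j - 1) by ring]
    refine X_pow_dvd_iff.mp (Dvd.dvd.mul_right (X_pow_dvd_iff.mpr fun m hm => ?_) _) d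
      (Nat.lt_succ_self d)
    exact coeff_thetaTerm_eq_zero h (by omega)
  · rw [show f (2 * a) * (thetaTerm a b (j - N) * qBinom (X ^ (2 * a)) (N + N) j) -
        thetaTerm a b (j - N) =
        (f (2 * a) * qBinom (X ^ (2 * a)) (N + N) j - 1) * thetaTerm a b (j - N) by ring]
    have hq := X_pow_dvd_f_mul_qBinom_sub_one h2a (d := d + 1) (m := N + N - j) (j := j)
      (by omega) (by omega)
    rw [Nat.sub_add_cancel (by omega)] at hq
    exact X_pow_dvd_iff.mp (hq.mul_right _) d (Nat.lt_succ_self d)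

/-! ### Product forms of the theta series -/

theorem theta_one_zero : theta 1 0 * f 2 = f 1 ^ 2 := by
  have h : ∀ N, (F (2 * 1) N * ((∏ k ∈ Finset.range N, (1 - (X : ℤ⟦X⟧) ^ (1 * (2 * k + 1) - 0))) *
      (∏ k ∈ Finset.range N, (1 - X ^ (1 * (2 * k + 1) + 0))))) * F 2 N = F 1 (2 * N) ^ 2 := by
    intro N
    induction N with
    | zero => simp [F_zero]
    | succ N ih =>
      rw [show 2 * (N + 1) = 2 * N + 1 + 1 by ring]
      simp only [F_succ, Finset.prod_range_succ, mul_pow, ← ih]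
      simp only [Nat.sub_zero, Nat.add_zero, mul_one, one_mul]
      ring
  refine tendsto_nhds_unique ((tendsto_jacobi one_pos).mul (tendsto_F two_pos)) ?_
  simp_rw [h]
  exact ((tendsto_F one_pos).comp (tendsto_id.const_mul_atTop' two_pos)).pow 2

theorem theta_three_one : theta 3 1 = f 2 := by
  have h : ∀ N, (F (2 * 3) N * ((∏ k ∈ Finset.range N, (1 - (X : ℤ⟦X⟧) ^ (3 * (2 * k + 1) - 1))) *
      (∏ k ∈ Finset.range N, (1 - X ^ (3 * (2 * k + 1) + 1))))) = F 2 (3 * N) := by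
    intro N
    induction N with
    | zero => simp [F_zero]
    | succ N ih =>
      rw [show 3 * (N + 1) = 3 * N + 1 + 1 + 1 by ring]
      simp only [F_succ, Finset.prod_range_succ, ← ih]
      rw [show 3 * (2 * N + 1) - 1 = 6 * N + 2 by omega]
      ring
  refine tendsto_nhds_unique (tendsto_jacobi (by norm_num)) ?_
  simp_rw [h]
  exact (tendsto_F two_pos).comp (tendsto_id.const_mul_atTop' three_pos)

/-- Count exponents modulo 6: the triple product supplies the classes 0, 1, 5, `f 2` supplies 0, 2,
4 and `f 3` supplies 0, 3. Together this is every class once and the class 0 two more times. -/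
theorem theta_three_two : theta 3 2 * f 2 * f 3 = f 1 * f 6 ^ 2 := by
  have h : ∀ N, (F (2 * 3) N * ((∏ k ∈ Finset.range N, (1 - (X : ℤ⟦X⟧) ^ (3 * (2 * k + 1) - 2))) *
      (∏ k ∈ Finset.range N, (1 - X ^ (3 * (2 * k + 1) + 2))))) * F 2 (3 * N) * F 3 (2 * N) =
      F 1 (6 * N) * F 6 N ^ 2 := by
    intro N
    induction N with
    | zero => simp [F_zero]
    | succ N ih =>
      rw [show 3 * (N + 1) = 3 * N + 1 + 1 + 1 by ring, show 2 * (N + 1) = 2 * N + 1 + 1 by ring,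
        show 6 * (N + 1) = 6 * N + 1 + 1 + 1 + 1 + 1 + 1 by ring]
      simp only [F_succ, Finset.prod_range_succ]
      rw [show 3 * (2 * N + 1) - 2 = 6 * N + 1 by omega]
      linear_combination (1 - (X : ℤ⟦X⟧) ^ (6 * N + 1)) * (1 - X ^ (6 * N + 2)) *
        (1 - X ^ (6 * N + 3)) * (1 - X ^ (6 * N + 4)) * (1 - X ^ (6 * N + 5)) *
        (1 - X ^ (6 * N + 6)) * (1 - X ^ (6 * N + 6)) ^ 2 * ih
  refine tendsto_nhds_unique (((tendsto_jacobi (by norm_num)).mul ((tendsto_F two_pos).comp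
    (tendsto_id.const_mul_atTop' three_pos))).mul ((tendsto_F three_pos).comp
    (tendsto_id.const_mul_atTop' two_pos))) ?_
  simp only [Function.comp_def, id]
  simp_rw [h]
  exact ((tendsto_F one_pos).comp (tendsto_id.const_mul_atTop' (by norm_num))).mul
    ((tendsto_F (by norm_num)).pow 2)

/-! ### Substitutions and dissections of theta series -/

theorem continuous_of_continuous_coeff {α R : Type*} [TopologicalSpace α] [TopologicalSpace R]
    [Semiring R] {g : α → R⟦X⟧} (h : ∀ d, Continuous fun x => coeff d (g x)) : Continuous g :=
  continuous_iff_continuousAt.mpr fun _ =>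
    (WithPiTopology.tendsto_iff_coeff_tendsto R _ _ _).mpr fun d => (h d).continuousAt

theorem continuous_expand {R : Type*} [TopologicalSpace R] [CommRing R] {p : ℕ} (hp : p ≠ 0) :
    Continuous (expand p hp : R⟦X⟧ → R⟦X⟧) := by
  refine continuous_of_continuous_coeff fun d => ?_
  simp_rw [coeff_expand]
  split_ifs
  · exact WithPiTopology.continuous_coeff R _
  · exact continuous_const

theorem continuous_rescale {R : Type*} [TopologicalSpace R] [CommRing R] [IsTopologicalRing R]
    (r : R) : Continuous (rescale r : R⟦X⟧ → R⟦X⟧) := by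
  refine continuous_of_continuous_coeff fun d => ?_
  simp_rw [coeff_rescale]
  exact (WithPiTopology.continuous_coeff R d).const_mul _

theorem expand_F {p : ℕ} (hp : p ≠ 0) (k n : ℕ) : expand p hp (F k n) = F (p * k) n := by
  simp only [F, map_prod, map_sub, map_one, map_pow, expand_X, ← pow_mul, mul_assoc]

theorem expand_f {p k : ℕ} (hp : p ≠ 0) (hk : 0 < k) : expand p hp (f k) = f (p * k) := by
  refine tendsto_nhds_unique (((continuous_expand hp).tendsto _).comp (tendsto_F hk)) ?_
  simp only [Function.comp_def, expand_F]
  exact tendsto_F (Nat.mul_pos (Nat.pos_of_ne_zero hp) hk)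

theorem hasSum_expand_theta {p a b : ℕ} (hp : p ≠ 0) (h : b < a) :
    HasSum (fun n => expand p hp (thetaTerm a b n)) (expand p hp (theta a b)) :=
  (hasSum_theta h).map (expand p hp : ℤ⟦X⟧ →ₐ[ℤ] ℤ⟦X⟧) (continuous_expand hp)

theorem thetaTerm_eq_expand {a b a' b' p : ℕ} (hp : p ≠ 0) (h : b < a) (h' : b' < a') {m n : ℤ}
    (hs : Even (m - n)) (he : (a * m ^ 2 + b * m : ℤ) = p * (a' * n ^ 2 + b' * n)) :
    thetaTerm a b m = expand p hp (thetaTerm a' b' n) := by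
  rw [thetaTerm, thetaTerm, expand_monomial, (Int.negOnePow_eq_iff m n).mpr hs]
  congr 2
  zify
  rw [coe_toNat_quadratic h, coe_toNat_quadratic h', he]

theorem thetaTerm_eq_neg_X_mul_expand {a b a' b' p : ℕ} (hp : p ≠ 0) (h : b < a) (h' : b' < a')
    {m n : ℤ} (hs : Odd (m - n))
    (he : (a * m ^ 2 + b * m : ℤ) = 1 + p * (a' * n ^ 2 + b' * n)) :
    thetaTerm a b m = -(X * expand p hp (thetaTerm a' b' n)) := by
  have e : m.negOnePow = -n.negOnePow := by
    rw [show m = (m - n) + n by ring, Int.negOnePow_add, Int.negOnePow_odd _ hs]; simp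
  have e2 : (a * m ^ 2 + b * m : ℤ).toNat = 1 + p * (a' * n ^ 2 + b' * n : ℤ).toNat := by
    zify
    rw [coe_toNat_quadratic h, coe_toNat_quadratic h', he]
  rw [thetaTerm, thetaTerm, expand_monomial, ← pow_one X, X_pow_eq, monomial_mul_monomial, one_mul,
    e, e2, Units.val_neg, map_neg]

/-- The `3`-dissection of `φ(-q)`. -/
theorem theta_one_zero_dissection :
    theta 1 0 = expand 9 (by norm_num) (theta 1 0) -
      2 * X * expand 3 (by norm_num) (theta 3 2) := by
  -- The class 2 modulo 3 is parametrized as -(3k+1), so that both nonzero classes give the same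
  -- series, by (3k+1)² = 1 + 3(3k²+2k).
  let e : ℤ ⊕ ℤ ⊕ ℤ → ℤ := Sum.elim (fun k => 3 * k) (Sum.elim (fun k => 3 * k + 1)
    (fun k => -(3 * k + 1)))
  have he : Function.Bijective e := by
    constructor
    · rintro (i | i | i) (j | j | j) hij <;> simp only [e, Sum.elim_inl, Sum.elim_inr] at hij <;>
        first | omega | (congr; omega)
    · intro n
      have : n % 3 = 0 ∨ n % 3 = 1 ∨ n % 3 = 2 := by omega
      rcases this with h | h | h
      · exact ⟨.inl (n / 3), by simp only [e, Sum.elim_inl]; omega⟩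
      · exact ⟨.inr (.inl (n / 3)), by simp only [e, Sum.elim_inl, Sum.elim_inr]; omega⟩
      · exact ⟨.inr (.inr ((-n) / 3)), by simp only [e, Sum.elim_inr]; omega⟩
  have h0 := (Equiv.hasSum_iff (Equiv.ofBijective e he)).mpr (hasSum_theta (a := 1) (b := 0) one_pos)
  have h1 : HasSum (fun k : ℤ => thetaTerm 1 0 (3 * k)) (expand 9 (by norm_num) (theta 1 0)) := by
    convert hasSum_expand_theta (p := 9) (by norm_num) (a := 1) (b := 0) one_pos using 2 with k
    exact thetaTerm_eq_expand _ one_pos one_pos ⟨k, by ring⟩ (by push_cast; ring)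
  have h2 : HasSum (fun k : ℤ => thetaTerm 1 0 (3 * k + 1))
      (-(X * expand 3 (by norm_num) (theta 3 2))) := by
    have e : ∀ k : ℤ, thetaTerm 1 0 (3 * k + 1) =
        -(X * expand 3 (by norm_num) (thetaTerm 3 2 k)) := fun k =>
      thetaTerm_eq_neg_X_mul_expand _ one_pos (by norm_num) ⟨k, by ring⟩ (by push_cast; ring)
    simp_rw [e]
    exact ((hasSum_expand_theta (p := 3) (by norm_num) (by norm_num)).mul_left X).neg
  have h3 : HasSum (fun k : ℤ => thetaTerm 1 0 (-(3 * k + 1)))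
      (-(X * expand 3 (by norm_num) (theta 3 2))) := by
    convert h2 using 2 with k
    simp only [thetaTerm, Int.negOnePow_neg]
    congr 2
    push_cast
    ring_nf
  have := h0.unique (HasSum.sum (f := thetaTerm 1 0 ∘ e) h1 (HasSum.sum h2 h3))
  refine this.trans ?_
  ring

theorem rescale_monomial_int (n : ℕ) (r c : ℤ) :
    rescale r (monomial n c) = monomial n (r ^ n * c) := by
  ext d
  rw [coeff_rescale, coeff_monomial, coeff_monomial]
  split_ifs with h
  · rw [h]
  · simp

/-- The signs cancel because 3n² + n is even: the rescaled series is φ(q³). -/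
theorem rescale_thetaTerm_three_zero (n : ℤ) :
    rescale (-1) (thetaTerm 3 0 n) = monomial (3 * n ^ 2 : ℤ).toNat 1 := by
  rw [thetaTerm, rescale_monomial_int]
  simp only [Nat.cast_ofNat, Nat.cast_zero, zero_mul, add_zero]
  congr 1
  rw [← Int.coe_negOnePow_natCast, ← Units.val_mul, ← Int.negOnePow_add,
    Int.toNat_of_nonneg (by positivity), Int.negOnePow_even, Units.val_one]
  rw [show 3 * n ^ 2 + n = 2 * n ^ 2 + n * (n + 1) by ring]
  exact (even_two_mul _).add (Int.even_mul_succ_self n)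

theorem hasSum_rescale_theta_three_zero :
    HasSum (fun n : ℤ => (monomial (3 * n ^ 2 : ℤ).toNat 1 : ℤ⟦X⟧)) (rescale (-1) (theta 3 0)) := by
  simp_rw [← rescale_thetaTerm_three_zero]
  exact (hasSum_theta (by norm_num)).map (rescale (-1 : ℤ)) (continuous_rescale _)

theorem summable_monomial {ι : Type*} {e : ι → ℕ} {c : ι → ℤ} (h : ∀ d, {i | e i = d}.Finite) :
    Summable fun i => (monomial (e i) (c i) : ℤ⟦X⟧) := by
  refine (WithPiTopology.summable_iff_summable_coeff _).mpr fun d => ?_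
  refine summable_of_hasFiniteSupport ((h d).subset fun i hi => ?_)
  by_contra hn
  refine hi ?_
  simp only [coeff_monomial]
  exact if_neg fun h => hn h.symm

theorem finite_int_pairs {e : ℤ × ℤ → ℕ} (h : ∀ i, i.1.natAbs ≤ e i ∧ i.2.natAbs ≤ e i) (d : ℕ) :
    {i | e i = d}.Finite := by
  refine ((Set.finite_Icc (-(d : ℤ)) d).prod (Set.finite_Icc (-(d : ℤ)) d)).subset fun i hi => ?_
  have := h i
  rw [Set.mem_ofPred_eq] at hi
  simp only [Set.mem_prod, Set.mem_Icc]
  omega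

theorem natAbs_le_toNat_three_mul_sq (n : ℤ) : n.natAbs ≤ (3 * n ^ 2 : ℤ).toNat := by
  simpa using abs_le_toNat_quadratic (a := 3) (b := 0) (by norm_num) n

theorem hasSum_mul_int_pairs {s t : ℤ → ℤ⟦X⟧} {a b : ℤ⟦X⟧} (hs : HasSum s a) (ht : HasSum t b)
    (h : Summable fun i : ℤ × ℤ => s i.1 * t i.2) :
    HasSum (fun i : ℤ × ℤ => s i.1 * t i.2) (a * b) := hs.mul ht h

theorem hasSum_expand_two_theta_sq {a b : ℕ} (h : b < a) :
    HasSum (fun i : ℤ × ℤ => expand 2 two_ne_zero (thetaTerm a b i.1) *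
      expand 2 two_ne_zero (thetaTerm a b i.2)) (expand 2 two_ne_zero (theta a b) ^ 2) := by
  have hs := hasSum_expand_theta two_ne_zero h
  have hm : Summable fun i : ℤ × ℤ => expand 2 two_ne_zero (thetaTerm a b i.1) *
      expand 2 two_ne_zero (thetaTerm a b i.2) := by
    simp only [thetaTerm, expand_monomial, monomial_mul_monomial]
    refine summable_monomial (finite_int_pairs fun i => ?_)
    have := abs_le_toNat_quadratic h i.1
    have := abs_le_toNat_quadratic h i.2
    constructor <;> omega
  have := hasSum_mul_int_pairs hs hs hm
  rw [sq]
  exact this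

/-- The `2`-dissection of `Ω(-q) φ(q³)`. -/
theorem theta_mul_theta_dissection :
    theta 3 2 * rescale (-1) (theta 3 0) = expand 2 two_ne_zero (theta 3 1) ^ 2 -
      X * expand 2 two_ne_zero (theta 3 2) ^ 2 := by
  -- The pairs (n, m) are split by the parity of n + m. These rotations diagonalize 3n² + 2n + 3m²:
  -- it becomes 2(3i²+i) + 2(3j²+j) on even pairs and 1 + 2(3i²+2i) + 2(3j²+2j) on odd ones.
  let e : (ℤ × ℤ) ⊕ (ℤ × ℤ) → ℤ × ℤ := Sum.elim (fun i => (i.1 + i.2, i.1 - i.2))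
    (fun i => (-(i.1 + i.2 + 1), i.1 - i.2))
  have he : Function.Bijective e := by
    constructor
    · rintro (⟨i, i'⟩ | ⟨i, i'⟩) (⟨j, j'⟩ | ⟨j, j'⟩) hij <;>
        simp only [e, Sum.elim_inl, Sum.elim_inr, Prod.mk.injEq] at hij <;>
        first | omega | (congr 2 <;> omega)
    · rintro ⟨n, m⟩
      have : (n + m) % 2 = 0 ∨ (n + m) % 2 = 1 := by omega
      rcases this with h | h
      · exact ⟨.inl ((n + m) / 2, (n - m) / 2), by
          simp only [e, Sum.elim_inl, Prod.mk.injEq]; omega⟩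
      · exact ⟨.inr ((-n - 1 + m) / 2, (-n - 1 - m) / 2), by
          simp only [e, Sum.elim_inr, Prod.mk.injEq]; omega⟩
  let t : ℤ × ℤ → ℤ⟦X⟧ := fun i => thetaTerm 3 2 i.1 * monomial (3 * i.2 ^ 2 : ℤ).toNat 1
  have hsum : HasSum t (theta 3 2 * rescale (-1) (theta 3 0)) := by
    have hs : HasSum (thetaTerm 3 2) (theta 3 2) := hasSum_theta (by norm_num)
    have hm : Summable t := by
      simp only [t, thetaTerm, monomial_mul_monomial]
      refine summable_monomial (finite_int_pairs fun i => ?_)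
      have := abs_le_toNat_quadratic (a := 3) (b := 2) (by norm_num) i.1
      have := natAbs_le_toNat_three_mul_sq i.2
      constructor <;> omega
    have := hasSum_mul_int_pairs hs hasSum_rescale_theta_three_zero hm
    exact this
  have h0 := (Equiv.hasSum_iff (Equiv.ofBijective e he)).mpr hsum
  have h1 : HasSum (fun i : ℤ × ℤ => t (i.1 + i.2, i.1 - i.2))
      (expand 2 two_ne_zero (theta 3 1) ^ 2) := by
    convert hasSum_expand_two_theta_sq (a := 3) (b := 1) (by norm_num) using 2 with i
    simp only [t, thetaTerm, expand_monomial, monomial_mul_monomial, mul_one, ← Units.val_mul,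
      ← Int.negOnePow_add]
    congr 2
    apply Int.natCast_inj.mp
    simp only [Nat.cast_add, Nat.cast_mul]
    simp only [coe_toNat_quadratic (show 2 < 3 by norm_num),
      coe_toNat_quadratic (show 1 < 3 by norm_num)]
    rw [Int.toNat_of_nonneg (by positivity)]
    push_cast
    ring
  have h2 : HasSum (fun i : ℤ × ℤ => t (-(i.1 + i.2 + 1), i.1 - i.2))
      (-(X * expand 2 two_ne_zero (theta 3 2) ^ 2)) := by
    have ht : ∀ i : ℤ × ℤ, t (-(i.1 + i.2 + 1), i.1 - i.2) =
        -(X * (expand 2 two_ne_zero (thetaTerm 3 2 i.1) *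
          expand 2 two_ne_zero (thetaTerm 3 2 i.2))) := by
      intro i
      simp only [t, thetaTerm, expand_monomial, monomial_mul_monomial, mul_one, ← Units.val_mul,
        ← Int.negOnePow_add, Int.negOnePow_neg, Int.negOnePow_succ, Units.val_neg, map_neg]
      rw [← pow_one X, X_pow_eq, monomial_mul_monomial, one_mul]
      congr 3
      apply Int.natCast_inj.mp
      simp only [Nat.cast_add, Nat.cast_mul]
      simp only [coe_toNat_quadratic (show 2 < 3 by norm_num)]
      rw [Int.toNat_of_nonneg (by positivity)]
      push_cast
      ring
    simp_rw [ht]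
    exact ((hasSum_expand_two_theta_sq (a := 3) (b := 2) (by norm_num)).mul_left X).neg
  rw [h0.unique (HasSum.sum (f := t ∘ e) h1 h2), ← sub_eq_add_neg]

theorem theta_three_zero : theta 3 0 = expand 3 three_ne_zero (theta 1 0) := by
  refine (hasSum_theta (by norm_num)).unique ?_
  convert hasSum_expand_theta (p := 3) three_ne_zero (a := 1) (b := 0) one_pos using 2 with n
  exact thetaTerm_eq_expand _ (by norm_num) one_pos (by simp) (by push_cast; ring)

/-! ### The sign change q ↦ -q -/

theorem tendsto_F_mul {k c : ℕ} (hk : 0 < k) (hc : 0 < c) :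
    Tendsto (fun N => F k (c * N)) atTop (𝓝 (f k)) :=
  (tendsto_F hk).comp (tendsto_id.const_mul_atTop' hc)

/-- For odd k the substitution changes exactly the factors with odd index, and there (1 + x)(1 - x)
= 1 - x². -/
theorem rescale_neg_one_F_two_mul {k : ℕ} (hk : Odd k) (N : ℕ) :
    rescale (-1) (F k (2 * N)) * F k (2 * N) * F (4 * k) N =
      F (2 * k) (2 * N) * F (2 * k) N ^ 2 := by
  induction N with
  | zero => simp [F_zero]
  | succ N ih =>
    rw [show 2 * (N + 1) = 2 * N + 1 + 1 by ring]
    simp only [F_succ, map_mul, map_sub, map_one, map_pow, rescale_neg_one_X]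
    have h1 : (-(X : ℤ⟦X⟧)) ^ (k * (2 * N + 1)) = -X ^ (k * (2 * N + 1)) :=
      (hk.mul (odd_two_mul_add_one N)).neg_pow X
    have h2 : (-(X : ℤ⟦X⟧)) ^ (k * (2 * N + 1 + 1)) = X ^ (k * (2 * N + 1 + 1)) :=
      Even.neg_pow ⟨k * (N + 1), by ring⟩ X
    rw [h1, h2]
    linear_combination (1 - (X : ℤ⟦X⟧) ^ (2 * k * (2 * N + 1))) *
      (1 - X ^ (k * (2 * N + 1 + 1))) ^ 2 * (1 - X ^ (4 * k * (N + 1))) * ih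

theorem rescale_neg_one_f {k : ℕ} (hk : Odd k) :
    rescale (-1) (f k) * f k * f (4 * k) = f (2 * k) ^ 3 := by
  have h0 : 0 < k := hk.pos
  have h1 : Tendsto (fun N => rescale (-1) (F k (2 * N)) * F k (2 * N) * F (4 * k) N) atTop
      (𝓝 (rescale (-1) (f k) * f k * f (4 * k))) :=
    ((((continuous_rescale (-1 : ℤ)).tendsto _).comp (tendsto_F_mul h0 two_pos)).mul
      (tendsto_F_mul h0 two_pos)).mul (tendsto_F (by omega))
  refine tendsto_nhds_unique h1 ?_
  simp_rw [rescale_neg_one_F_two_mul hk]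
  rw [pow_succ' _ 2]
  exact (tendsto_F_mul (by omega) two_pos).mul ((tendsto_F (by omega)).pow 2)

theorem rescale_neg_one_expand_two (p : ℤ⟦X⟧) :
    rescale (-1) (expand 2 two_ne_zero p) = expand 2 two_ne_zero p := by
  ext d
  rw [coeff_rescale, coeff_expand]
  split_ifs with h
  · rw [Even.neg_one_pow (even_iff_two_dvd.mpr h), one_mul]
  · simp

theorem rescale_neg_one_expand_three (p : ℤ⟦X⟧) :
    rescale (-1) (expand 3 three_ne_zero p) = expand 3 three_ne_zero (rescale (-1) p) := by
  ext d
  rw [coeff_rescale, coeff_expand, coeff_expand]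
  split_ifs with h
  · obtain ⟨c, rfl⟩ := h
    rw [Nat.mul_div_cancel_left c three_pos, coeff_rescale, pow_mul]
    norm_num
  · simp

/-! ### The norm over cube roots of unity and the cubic theta identity -/

/-- Evaluation of an integral power series at `ω X`, as a complex power series. -/
noncomputable def evalMulX (ω : ℂ) : ℤ⟦X⟧ →+* ℂ⟦X⟧ :=
  (rescale ω).comp (PowerSeries.map (Int.castRingHom ℂ))

theorem coeff_evalMulX (ω : ℂ) (p : ℤ⟦X⟧) (d : ℕ) :
    coeff d (evalMulX ω p) = ω ^ d * (coeff d p : ℤ) := by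
  simp [evalMulX, coeff_rescale]

theorem evalMulX_X (ω : ℂ) : evalMulX ω X = C ω * X := by
  simp [evalMulX, rescale_X]

theorem continuous_evalMulX (ω : ℂ) : Continuous (evalMulX ω) := by
  refine continuous_of_continuous_coeff fun d => ?_
  simp_rw [coeff_evalMulX]
  exact ((continuous_of_discreteTopology (f := fun n : ℤ => (n : ℂ))).comp
    (WithPiTopology.continuous_coeff ℤ d)).const_mul _

theorem evalMulX_one_injective : Function.Injective (evalMulX 1) := fun p q h => by
  ext d
  have := congrArg (coeff d) h
  simpa [coeff_evalMulX] using this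

theorem evalMulX_expand_three {ω : ℂ} (hω : ω ^ 3 = 1) (p : ℤ⟦X⟧) :
    evalMulX ω (expand 3 three_ne_zero p) = evalMulX 1 (expand 3 three_ne_zero p) := by
  ext d
  rw [coeff_evalMulX, coeff_evalMulX, coeff_expand]
  split_ifs with h
  · obtain ⟨c, rfl⟩ := h
    rw [pow_mul, hω, one_pow, one_pow]
  · simp

/-- The norm of a power series to the series in `X³`. -/
noncomputable def cubeNorm (ω : ℂ) (p : ℤ⟦X⟧) : ℂ⟦X⟧ :=
  evalMulX 1 p * evalMulX ω p * evalMulX (ω ^ 2) p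

theorem cubeNorm_mul (ω : ℂ) (p q : ℤ⟦X⟧) : cubeNorm ω (p * q) = cubeNorm ω p * cubeNorm ω q := by
  simp only [cubeNorm, map_mul]; ring

section
variable {ω : ℂ} (hω : ω ^ 2 + ω + 1 = 0)
include hω

theorem pow_three_eq_one : ω ^ 3 = 1 := by linear_combination (ω - 1) * hω

/-- When 3 ∤ n, the powers 1, ω^n, ω^(2n) are the three cube roots of unity, and the product of 1 -
ζx over them is 1 - x³. -/
theorem cubeNorm_one_sub_X_pow {n : ℕ} (hn : ¬ 3 ∣ n) :
    cubeNorm ω (1 - X ^ n) = evalMulX 1 (1 - X ^ (3 * n)) := by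
  have hc : (C ω : ℂ⟦X⟧) ^ 2 + C ω + 1 = 0 := by simpa using congrArg (C (R := ℂ)) hω
  have hc3 : (C ω : ℂ⟦X⟧) ^ 3 = 1 := by linear_combination (C ω - 1) * hc
  have hz : ((C ω : ℂ⟦X⟧) ^ n) ^ 2 + C ω ^ n + 1 = 0 := by
    have : n % 3 = 1 ∨ n % 3 = 2 := by omega
    rw [← Nat.div_add_mod n 3, pow_add, pow_mul, hc3, one_pow, one_mul]
    rcases this with h | h <;> rw [h]
    · linear_combination hc
    · linear_combination hc + C ω * hc3
  simp only [cubeNorm, map_sub, map_one, map_pow, evalMulX_X, mul_pow, one_mul]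
  rw [← pow_mul, mul_comm 2 n, pow_mul]
  generalize (C ω : ℂ⟦X⟧) ^ n = z at hz
  linear_combination (-(X : ℂ⟦X⟧) ^ n + X ^ (2 * n) * z - (z - 1) * X ^ (3 * n)) * hz

theorem cubeNorm_one_sub_X_pow_of_dvd {n : ℕ} (hn : 3 ∣ n) :
    cubeNorm ω (1 - X ^ n) = evalMulX 1 (1 - X ^ n) ^ 3 := by
  have hc : (C ω : ℂ⟦X⟧) ^ 3 = 1 := by simpa using congrArg (C (R := ℂ)) (pow_three_eq_one hω)
  obtain ⟨m, rfl⟩ := hn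
  simp only [cubeNorm, map_sub, map_one, map_pow, evalMulX_X, mul_pow, one_mul]
  rw [← pow_mul, show 2 * (3 * m) = 3 * (2 * m) by ring, pow_mul (C ω) 3, pow_mul (C ω) 3, hc]
  simp only [one_pow]
  ring

/-- Factors with index prime to 3 have X replaced by X³, the others are cubed. Multiplying by `F (9
* k) N` fills in the missing indices of `F (3 * k) (3 * N)`. -/
theorem cubeNorm_F {k : ℕ} (hk : ¬ 3 ∣ k) (N : ℕ) :
    cubeNorm ω (F k (3 * N)) * evalMulX 1 (F (9 * k) N) =
      evalMulX 1 (F (3 * k) (3 * N)) * evalMulX 1 (F (3 * k) N) ^ 3 := by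
  induction N with
  | zero => simp [F_zero, cubeNorm]
  | succ N ih =>
    have h1 : ¬ 3 ∣ k * (3 * N + 1) := by
      rw [Nat.prime_three.dvd_mul]; omega
    have h2 : ¬ 3 ∣ k * (3 * N + 1 + 1) := by
      rw [Nat.prime_three.dvd_mul]; omega
    have h3 : 3 ∣ k * (3 * N + 1 + 1 + 1) := ⟨k * (N + 1), by ring⟩
    rw [show 3 * (N + 1) = 3 * N + 1 + 1 + 1 by ring]
    simp only [F_succ, cubeNorm_mul]
    rw [cubeNorm_one_sub_X_pow hω h1, cubeNorm_one_sub_X_pow hω h2,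
      cubeNorm_one_sub_X_pow_of_dvd hω h3]
    rw [show 3 * k * (3 * N + 1) = 3 * (k * (3 * N + 1)) by ring,
      show 3 * k * (3 * N + 1 + 1) = 3 * (k * (3 * N + 1 + 1)) by ring,
      show 3 * k * (3 * N + 1 + 1 + 1) = 9 * k * (N + 1) by ring,
      show k * (3 * N + 1 + 1 + 1) = 3 * k * (N + 1) by ring]
    simp only [map_mul, mul_pow]
    linear_combination evalMulX 1 (1 - X ^ (3 * (k * (3 * N + 1)))) *
      evalMulX 1 (1 - X ^ (3 * (k * (3 * N + 1 + 1)))) * evalMulX 1 (1 - X ^ (3 * k * (N + 1))) ^ 3 *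
      evalMulX 1 (1 - X ^ (9 * k * (N + 1))) * ih

theorem cubeNorm_f {k : ℕ} (h0 : 0 < k) (hk : ¬ 3 ∣ k) :
    cubeNorm ω (f k) * evalMulX 1 (f (9 * k)) = evalMulX 1 (f (3 * k)) ^ 4 := by
  have ht : ∀ (η : ℂ) {j c : ℕ}, 0 < j → 0 < c →
      Tendsto (fun N => evalMulX η (F j (c * N))) atTop (𝓝 (evalMulX η (f j))) := fun η j c hj hc =>
    ((continuous_evalMulX η).tendsto _).comp (tendsto_F_mul hj hc)
  have h1 : Tendsto (fun N => cubeNorm ω (F k (3 * N)) * evalMulX 1 (F (9 * k) (1 * N))) atTop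
      (𝓝 (cubeNorm ω (f k) * evalMulX 1 (f (9 * k)))) :=
    (((ht 1 h0 three_pos).mul (ht ω h0 three_pos)).mul (ht (ω ^ 2) h0 three_pos)).mul
      (ht 1 (by omega) one_pos)
  refine tendsto_nhds_unique h1 ?_
  simp_rw [one_mul, cubeNorm_F hω hk]
  rw [pow_succ' _ 3]
  have h2 := ht 1 (j := 3 * k) (c := 1) (by omega) one_pos
  simp_rw [one_mul] at h2
  exact (ht 1 (by omega) three_pos).mul (h2.pow 3)

/-- In φ(-q) = A - 2qB both A and B are series in q³, hence fixed by q ↦ ωq, and the product of A -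
2ζqB over the cube roots of unity ζ is A³ - 8q³B³. -/
theorem cubeNorm_theta_one_zero :
    cubeNorm ω (theta 1 0) =
      evalMulX 1 (expand 3 three_ne_zero (theta 3 0 ^ 3 - 8 * X * theta 3 2 ^ 3)) := by
  have hc : (C ω : ℂ⟦X⟧) ^ 2 + C ω + 1 = 0 := by simpa using congrArg (C (R := ℂ)) hω
  have hc3 : (C ω : ℂ⟦X⟧) ^ 3 = 1 := by linear_combination (C ω - 1) * hc
  have h3 := pow_three_eq_one hω
  have h9 : theta 1 0 = expand 3 three_ne_zero (theta 3 0) -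
      2 * X * expand 3 three_ne_zero (theta 3 2) := by
    rw [theta_three_zero, ← expand_mul 3 three_ne_zero 3 three_ne_zero]
    exact theta_one_zero_dissection
  have hω2 : (ω ^ 2) ^ 3 = 1 := by rw [← pow_mul, mul_comm, pow_mul, h3, one_pow]
  rw [h9, cubeNorm]
  simp only [map_sub, map_mul, map_pow, map_ofNat, evalMulX_expand_three h3,
    evalMulX_expand_three hω2, evalMulX_X, expand_X, map_one, one_mul]
  generalize evalMulX 1 (expand 3 three_ne_zero (theta 3 0)) = a
  generalize evalMulX 1 (expand 3 three_ne_zero (theta 3 2)) = b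
  generalize (C ω : ℂ⟦X⟧) = c at hc hc3
  linear_combination (-2 * X * a ^ 2 * b + 4 * X ^ 2 * a * b ^ 2 * c) * hc -
    8 * X ^ 3 * b ^ 3 * hc3

end

theorem expand_three_injective :
    Function.Injective (expand 3 three_ne_zero : ℤ⟦X⟧ → ℤ⟦X⟧) := fun p q h => by
  ext d
  have := congrArg (coeff (3 * d)) h
  simpa only [coeff_expand_mul] using this

/-- The norm of φ(-q) = f₁²/f₂ is computed twice: from the 3-dissection, and from `cubeNorm_f`
applied to f₁ and f₂. Comparison happens in ℂ⟦X⟧ after q ↦ q³, and both maps into that ring are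
injective. -/
theorem theta_cubic :
    (theta 3 0 ^ 3 - 8 * X * theta 3 2 ^ 3) * f 2 ^ 4 * f 3 ^ 2 = f 1 ^ 8 * f 6 := by
  obtain ⟨ω, hω⟩ : ∃ ω : ℂ, ω ^ 2 + ω + 1 = 0 := by
    obtain ⟨z, hz⟩ := IsAlgClosed.exists_pow_nat_eq (-3 : ℂ) two_pos
    exact ⟨(z - 1) / 2, by linear_combination hz / 4⟩
  refine expand_three_injective (evalMulX_one_injective ?_)
  have e : ∀ k, 0 < k → expand 3 three_ne_zero (f k) = f (3 * k) := fun k hk => expand_f _ hk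
  rw [map_mul, map_mul, map_mul, map_mul, ← cubeNorm_theta_one_zero hω]
  simp only [map_mul, map_pow, e 1 one_pos, e 2 two_pos, e 3 three_pos, e 6 (by norm_num)]
  norm_num
  have h1 := cubeNorm_f hω one_pos (by norm_num)
  have h2 := cubeNorm_f hω two_pos (by norm_num)
  norm_num at h1 h2
  have h := congrArg (cubeNorm ω) theta_one_zero
  rw [sq, cubeNorm_mul, cubeNorm_mul] at h
  linear_combination (-cubeNorm ω (theta 1 0) * evalMulX 1 (f 9) ^ 2) * h2 +
    (evalMulX 1 (f 18) * evalMulX 1 (f 9) ^ 2) * h +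
    evalMulX 1 (f 18) * (cubeNorm ω (f 1) * evalMulX 1 (f 9) + evalMulX 1 (f 3) ^ 4) * h1

/-! ### The generating function as an eta quotient -/

/-- Part sizes allowed in `9`-Schur overpartitions. -/
def IsSchurPart (a : ℕ) : Prop := a % 2 = 1 ∧ a % 9 ≠ 0

instance : DecidablePred IsSchurPart := fun a => by unfold IsSchurPart; infer_instance

theorem exists_mem_residues_iff (a : ℕ) :
    (∃ i ∈ residues 9, a ≡ i [MOD 2 * 9]) ↔ IsSchurPart a := by
  have h : ∀ r < 18, (∃ i ∈ residues 9, r % 18 = i % 18) ↔ r % 2 = 1 ∧ r % 9 ≠ 0 := by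
    decide
  have h2 := h (a % 18) (Nat.mod_lt _ (by norm_num))
  unfold IsSchurPart Nat.ModEq
  rw [Nat.mod_mod, Nat.mod_mod_of_dvd _ (by norm_num), Nat.mod_mod_of_dvd _ (by norm_num)] at h2
  exact h2

/-- The weight of a part size in the generating function of `9`-Schur overpartitions. -/
def schurWeight (i _c : ℕ) : ℤ := if IsSchurPart i then 2 else 0

/-- A partition into admissible parts carries 2^(number of distinct sizes) overlinings, so each size
has weight 2 whatever its multiplicity; an inadmissible size has weight 0. -/
theorem numSchur_eq_sum (n : ℕ) :
    (numSchur 9 n : ℤ) = ∑ p : n.Partition, p.parts.toFinsupp.prod schurWeight := by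
  have h : schurOverpartitions 9 n =
      Finset.univ.sigma fun p : n.Partition =>
        if ∀ a ∈ p.parts, IsSchurPart a then p.parts.toFinset.powerset else ∅ := by
    ext ⟨p, s⟩
    simp only [schurOverpartitions, overpartitions, Finset.mem_filter, Finset.mem_sigma,
      Finset.mem_univ, true_and, exists_mem_residues_iff]
    split_ifs with hp
    · exact and_iff_left hp
    · simp [hp]
  rw [numSchur, h, Finset.card_sigma, Nat.cast_sum]
  refine Finset.sum_congr rfl fun p _ => ?_
  rw [Finsupp.prod, Multiset.toFinsupp_support]
  split_ifs with hp
  · rw [Finset.prod_congr rfl fun a ha =>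
      show schurWeight a _ = 2 from if_pos (hp a (Multiset.mem_toFinset.mp ha))]
    simp
  · push Not at hp
    obtain ⟨a, ha, hpa⟩ := hp
    rw [Finset.prod_eq_zero (Multiset.mem_toFinset.mpr ha) (if_neg hpa)]
    simp

/-- The generating function of `9`-Schur overpartitions. -/
noncomputable def schurSeries : ℤ⟦X⟧ := PowerSeries.mk fun n => (numSchur 9 n : ℤ)

/-- The generating function `(1 + X^m) / (1 - X^m)` of the overpartitions with all parts `m`. -/
noncomputable def partFactor (m : ℕ) : ℤ⟦X⟧ := (1 + X ^ m) * ∑' j : ℕ, (X ^ m) ^ j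

theorem partFactor_mul {m : ℕ} (hm : 0 < m) : partFactor m * (1 - X ^ m) = 1 + X ^ m := by
  rw [partFactor, mul_assoc, WithPiTopology.tsum_pow_mul_one_sub_of_constantCoeff_eq_zero
    (by simp [hm.ne']), mul_one]

theorem partFactor_eq {m : ℕ} (hm : 0 < m) :
    partFactor m = 1 + ∑' j : ℕ, (2 : ℤ) • (X : ℤ⟦X⟧) ^ (m * (j + 1)) := by
  have hc : constantCoeff (X ^ m : ℤ⟦X⟧) = 0 := by simp [hm.ne']
  have hs := WithPiTopology.summable_pow_of_constantCoeff_eq_zero hc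
  have h1 : ∑' j : ℕ, (2 : ℤ) • (X : ℤ⟦X⟧) ^ (m * (j + 1)) =
      2 * X ^ m * ∑' j : ℕ, (X ^ m) ^ j := by
    rw [← hs.tsum_mul_left]
    refine tsum_congr fun j => ?_
    rw [zsmul_eq_mul]
    push_cast
    ring
  have h2 := WithPiTopology.one_sub_mul_tsum_pow_of_constantCoeff_eq_zero hc
  rw [h1, partFactor]
  linear_combination h2

theorem hasProd_schurSeries :
    HasProd (fun i => if IsSchurPart (i + 1) then partFactor (i + 1) else 1) schurSeries := by
  have h1 : schurSeries = Nat.Partition.genFun schurWeight := by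
    ext n
    rw [schurSeries, coeff_mk, numSchur_eq_sum, Nat.Partition.coeff_genFun]
  have h2 : ∀ i, (if IsSchurPart (i + 1) then partFactor (i + 1) else 1) =
      1 + ∑' j : ℕ, schurWeight (i + 1) (j + 1) • (X : ℤ⟦X⟧) ^ ((i + 1) * (j + 1)) := fun i => by
    simp only [schurWeight]
    split_ifs
    · rw [partFactor_eq (Nat.succ_pos i)]
    · simp
  simp_rw [h1, h2]
  exact Nat.Partition.hasProd_genFun schurWeight

/-- The partial products of `∏ partFactor (k m)` over odd `m`. -/
noncomputable def oddProd (k n : ℕ) : ℤ⟦X⟧ := ∏ m ∈ Finset.range n, partFactor (k * (2 * m + 1))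

theorem oddProd_mul {k : ℕ} (hk : 0 < k) (N : ℕ) :
    oddProd k N * (F k (2 * N) ^ 2 * F (4 * k) N) = F (2 * k) N ^ 2 * F (2 * k) (2 * N) := by
  induction N with
  | zero => simp [oddProd, F_zero]
  | succ N ih =>
    have h := partFactor_mul (m := k * (2 * N + 1)) (Nat.mul_pos hk (Nat.succ_pos _))
    rw [oddProd, Finset.prod_range_succ, ← oddProd, show 2 * (N + 1) = 2 * N + 1 + 1 by ring]
    simp only [F_succ]
    linear_combination (1 - (X : ℤ⟦X⟧) ^ (k * (2 * N + 1))) * (1 - X ^ (k * (2 * N + 1 + 1))) ^ 2 *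
      (1 - X ^ (4 * k * (N + 1))) * oddProd k N * (F k (2 * N) ^ 2 * F (4 * k) N) * h +
      (1 - (X : ℤ⟦X⟧) ^ (k * (2 * N + 1))) * (1 + X ^ (k * (2 * N + 1))) *
      (1 - X ^ (k * (2 * N + 1 + 1))) ^ 2 * (1 - X ^ (4 * k * (N + 1))) * ih

/-- Each block of 18 consecutive integers has nine odd members, of which only the odd multiple of 9
is excluded; `oddProd 9` restores it. -/
theorem prod_range_mul_oddProd (N : ℕ) :
    (∏ i ∈ Finset.range (18 * N), if IsSchurPart (i + 1) then partFactor (i + 1) else 1) *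
      oddProd 9 N = oddProd 1 (9 * N) := by
  induction N with
  | zero => simp [oddProd]
  | succ N ih =>
    have e : ∀ r, IsSchurPart (18 * N + r) ↔ IsSchurPart r := fun r => by
      unfold IsSchurPart; omega
    rw [show 18 * (N + 1) = 18 * N + 18 by ring, show 9 * (N + 1) = 9 * N + 9 by ring]
    simp only [oddProd, Finset.prod_range_add, Finset.prod_range_one] at ih ⊢
    rw [← ih]
    simp only [add_assoc, e]
    simp only [Finset.prod_range_succ, Finset.prod_range_zero, IsSchurPart]
    norm_num
    ring_nf

theorem schurSeries_mul :
    schurSeries * (f 1 ^ 2 * f 4 * f 18 ^ 3) = f 2 ^ 3 * f 9 ^ 2 * f 36 := by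
  set P : ℕ → ℤ⟦X⟧ := fun N =>
    ∏ i ∈ Finset.range (18 * N), if IsSchurPart (i + 1) then partFactor (i + 1) else 1 with hP
  have hT : Tendsto P atTop (𝓝 schurSeries) :=
    hasProd_schurSeries.tendsto_prod_nat.comp (tendsto_id.const_mul_atTop' (by norm_num))
  have key : ∀ N, P N * (F 1 (18 * N) ^ 2 * F 4 (9 * N) * (F 18 (1 * N) ^ 2 * F 18 (2 * N))) =
      F 2 (9 * N) ^ 2 * F 2 (18 * N) * (F 9 (2 * N) ^ 2 * F 36 (1 * N)) := fun N => by
    have h1 := oddProd_mul one_pos (9 * N)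
    have h2 := oddProd_mul (k := 9) (by norm_num) N
    rw [← mul_assoc 2 9 N] at h1
    norm_num at h1 h2
    rw [one_mul, ← h1, ← h2, ← prod_range_mul_oddProd N]
    ring
  have t : ∀ {k c : ℕ}, 0 < k → 0 < c → Tendsto (fun N => F k (c * N)) atTop (𝓝 (f k)) :=
    tendsto_F_mul
  have hL := hT.mul ((((t one_pos (show 0 < 18 by norm_num)).pow 2).mul
    (t (show 0 < 4 by norm_num) (show 0 < 9 by norm_num))).mul
    (((t (show 0 < 18 by norm_num) one_pos).pow 2).mul (t (show 0 < 18 by norm_num) two_pos)))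
  have hR := (((t two_pos (show 0 < 9 by norm_num)).pow 2).mul
    (t two_pos (show 0 < 18 by norm_num))).mul
    (((t (show 0 < 9 by norm_num) two_pos).pow 2).mul (t (show 0 < 36 by norm_num) one_pos))
  simp_rw [key] at hL
  linear_combination tendsto_nhds_unique hL hR

/-! ### Theta ratios and the 6-dissection -/

theorem f_ne_zero {k : ℕ} (hk : 0 < k) : f k ≠ 0 := (isUnit_f hk).ne_zero

theorem expand_two_theta_three_one : expand 2 two_ne_zero (theta 3 1) = f 4 := by
  rw [theta_three_one, expand_f two_ne_zero two_pos]; norm_num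

theorem theta_three_zero_mul : theta 3 0 * f 6 = f 3 ^ 2 := by
  have := congrArg (expand 3 three_ne_zero) theta_one_zero
  rwa [map_mul, map_pow, expand_f _ two_pos, expand_f _ one_pos, ← theta_three_zero] at this

theorem isUnit_theta_three_zero : IsUnit (theta 3 0) :=
  isUnit_of_mul_isUnit_left (theta_three_zero_mul ▸ (isUnit_f three_pos).pow 2)

/-- `Ω(-q) / φ(-q³)`. -/
noncomputable def thetaRatio : ℤ⟦X⟧ := quot (f 1 * f 6 ^ 3) (f 2 * f 3 ^ 3)

/-- The even part of the `2`-dissection of `Ω(q) / φ(q³)`. -/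
noncomputable def evenPart : ℤ⟦X⟧ := quot (f 2 ^ 2 * f 6 ^ 2) (f 3 ^ 4)

/-- `φ(-q³)⁴ / φ(-q)⁴`. -/
noncomputable def invCubic : ℤ⟦X⟧ := quot (f 2 ^ 4 * f 3 ^ 8) (f 1 ^ 8 * f 6 ^ 4)

theorem thetaRatio_mul : thetaRatio * (f 2 * f 3 ^ 3) = f 1 * f 6 ^ 3 :=
  quot_mul_cancel _ ((isUnit_f two_pos).mul ((isUnit_f three_pos).pow 3))

theorem evenPart_mul : evenPart * f 3 ^ 4 = f 2 ^ 2 * f 6 ^ 2 :=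
  quot_mul_cancel _ ((isUnit_f three_pos).pow 4)

theorem invCubic_mul : invCubic * (f 1 ^ 8 * f 6 ^ 4) = f 2 ^ 4 * f 3 ^ 8 :=
  quot_mul_cancel _ (((isUnit_f one_pos).pow 8).mul ((isUnit_f (by norm_num)).pow 4))

theorem thetaRatio_mul_theta : thetaRatio * theta 3 0 = theta 3 2 := by
  have h0 : f 2 * f 3 ^ 3 * f 6 ≠ 0 := mul_ne_zero (mul_ne_zero (f_ne_zero two_pos)
    (pow_ne_zero _ (f_ne_zero three_pos))) (f_ne_zero (by norm_num))
  refine mul_right_cancel₀ h0 ?_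
  linear_combination theta 3 0 * f 6 * thetaRatio_mul + f 1 * f 6 ^ 3 * theta_three_zero_mul -
    f 3 ^ 2 * f 6 * theta_three_two

theorem evenPart_mul_theta_sq : evenPart * theta 3 0 ^ 2 = f 2 ^ 2 := by
  refine mul_right_cancel₀ (pow_ne_zero 2 (f_ne_zero (k := 6) (by norm_num))) ?_
  linear_combination evenPart * (theta 3 0 * f 6 + f 3 ^ 2) * theta_three_zero_mul + evenPart_mul

/-- This is `theta_cubic` divided by φ(-q³)³; it makes the rationalized denominator invertible with
an explicit inverse. -/
theorem invCubic_mul_eq_one : invCubic * (1 - 8 * X * thetaRatio ^ 3) = 1 := by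
  have h0 : theta 3 0 ^ 3 * (f 2 ^ 4 * f 3 ^ 2 * f 6 ^ 3) ≠ 0 :=
    mul_ne_zero (pow_ne_zero _ isUnit_theta_three_zero.ne_zero)
      (mul_ne_zero (mul_ne_zero (pow_ne_zero _ (f_ne_zero two_pos))
        (pow_ne_zero _ (f_ne_zero three_pos))) (pow_ne_zero _ (f_ne_zero (by norm_num))))
  refine mul_right_cancel₀ h0 ?_
  have h1 : (1 - 8 * X * thetaRatio ^ 3) * theta 3 0 ^ 3 =
      theta 3 0 ^ 3 - 8 * X * theta 3 2 ^ 3 := by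
    rw [← thetaRatio_mul_theta]; ring
  have h2 : theta 3 0 ^ 3 * f 6 ^ 3 = f 3 ^ 6 := by
    rw [← mul_pow, theta_three_zero_mul]; ring
  linear_combination invCubic * f 2 ^ 4 * f 3 ^ 2 * f 6 ^ 3 * h1 + invCubic * f 6 ^ 3 * theta_cubic +
    invCubic_mul - f 2 ^ 4 * f 3 ^ 2 * h2

/-- The classical φ(q)φ(-q) = φ(-q²)², at q³. -/
theorem rescale_theta_three_zero_mul :
    rescale (-1) (theta 3 0) * theta 3 0 = expand 2 two_ne_zero (theta 3 0) ^ 2 := by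
  have h1 := congrArg (rescale (-1)) theta_three_zero_mul
  have h6 : rescale (-1) (f 6) = f 6 := by
    rw [← expand_f two_ne_zero (k := 3) three_pos, rescale_neg_one_expand_two]
  rw [map_mul, map_pow, h6] at h1
  have h2 := rescale_neg_one_f (k := 3) (by decide)
  have h3 := congrArg (expand 2 two_ne_zero) theta_three_zero_mul
  rw [map_mul, map_pow, expand_f _ (by norm_num), expand_f _ three_pos] at h3
  norm_num at h2 h3
  have h0 : f 6 ^ 2 * f 12 ^ 2 ≠ 0 := mul_ne_zero (pow_ne_zero _ (f_ne_zero (by norm_num)))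
    (pow_ne_zero _ (f_ne_zero (by norm_num)))
  refine mul_right_cancel₀ h0 ?_
  have h4 := theta_three_zero_mul
  linear_combination theta 3 0 * f 6 * f 12 ^ 2 * h1 + rescale (-1) (f 3) ^ 2 * f 12 ^ 2 * h4 +
    (rescale (-1) (f 3) * f 3 * f 12 + f 6 ^ 3) * h2 -
    f 6 ^ 2 * (expand 2 two_ne_zero (theta 3 0) * f 12 + f 6 ^ 2) * h3

/-- Under q ↦ -q, `theta_mul_theta_dissection` reads Ω(q)φ(-q³) = f₄² + qΩ(-q²)². Dividing by
φ(q³)φ(-q³) = φ(-q⁶)² gives the claim. -/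
theorem rescale_thetaRatio :
    rescale (-1) thetaRatio = expand 2 two_ne_zero evenPart +
      X * expand 2 two_ne_zero thetaRatio ^ 2 := by
  have h1 := congrArg (rescale (-1)) theta_mul_theta_dissection
  rw [expand_two_theta_three_one] at h1
  have h4 : rescale (-1) (f 4) = f 4 := by
    rw [← expand_f two_ne_zero (k := 2) two_pos, rescale_neg_one_expand_two]
  have hRR : rescale (-1) (rescale (-1) (theta 3 0)) = theta 3 0 := by
    rw [rescale_rescale]; norm_num
  simp only [map_mul, map_sub, map_pow, rescale_neg_one_expand_two, rescale_neg_one_X, h4,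
    hRR] at h1
  have h2 := congrArg (rescale (-1)) thetaRatio_mul_theta
  have h3 := congrArg (expand 2 two_ne_zero) thetaRatio_mul_theta
  have h5 := congrArg (expand 2 two_ne_zero) evenPart_mul_theta_sq
  rw [map_mul] at h2 h3
  rw [map_mul, map_pow, map_pow, expand_f _ two_pos] at h5
  norm_num at h5
  have h6 := rescale_theta_three_zero_mul
  have h0 : expand 2 two_ne_zero (theta 3 0) ^ 2 ≠ 0 :=
    pow_ne_zero _ (isUnit_theta_three_zero.map _).ne_zero
  refine mul_right_cancel₀ h0 ?_
  linear_combination -rescale (-1) thetaRatio * h6 + theta 3 0 * h2 + h1 - h5 -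
    X * (expand 2 two_ne_zero thetaRatio * expand 2 two_ne_zero (theta 3 0) +
      expand 2 two_ne_zero (theta 3 2)) * h3

theorem expand_six (p : ℤ⟦X⟧) : expand 2 two_ne_zero (expand 3 three_ne_zero p) =
    expand 6 (by norm_num) p := (expand_mul 2 two_ne_zero 3 three_ne_zero p).symm

theorem expand_six' (p : ℤ⟦X⟧) : expand 3 three_ne_zero (expand 2 two_ne_zero p) =
    expand 6 (by norm_num) p := (expand_mul 3 three_ne_zero 2 two_ne_zero p).symm

theorem theta_one_zero_eq : theta 1 0 = expand 3 three_ne_zero (theta 3 0) *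
    (1 - 2 * X * expand 3 three_ne_zero thetaRatio) := by
  have h : theta 1 0 = expand 3 three_ne_zero (theta 3 0) -
      2 * X * expand 3 three_ne_zero (theta 3 2) := by
    rw [theta_three_zero, ← expand_mul 3 three_ne_zero 3 three_ne_zero]
    exact theta_one_zero_dissection
  rw [h, ← thetaRatio_mul_theta, map_mul]
  ring

theorem schurSeries_eq :
    schurSeries * (1 - 2 * X ^ 2 * expand 6 (by norm_num) thetaRatio) =
      1 + 2 * X * (expand 6 (by norm_num) evenPart +
        X ^ 3 * expand 6 (by norm_num) thetaRatio ^ 2) := by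
  have hE := congrArg (expand 2 two_ne_zero) theta_one_zero_eq
  have hR := congrArg (rescale (-1)) theta_one_zero_eq
  simp only [map_mul, map_sub, map_one, map_ofNat, rescale_neg_one_X, expand_X,
    rescale_neg_one_expand_three, rescale_thetaRatio, expand_six, map_add, map_pow,
    expand_six'] at hE hR
  have e1 := congrArg (expand 2 two_ne_zero) theta_one_zero
  have e2 := congrArg (rescale (-1)) theta_one_zero
  have e3 := congrArg (expand 6 (by norm_num)) theta_three_zero_mul
  have e4 := congrArg (expand 3 three_ne_zero) (congrArg (rescale (-1)) theta_three_zero_mul)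
  have r2 : rescale (-1) (f 2) = f 2 := by
    rw [← expand_f two_ne_zero (k := 1) one_pos, rescale_neg_one_expand_two]
  have r6 : rescale (-1) (f 6) = f 6 := by
    rw [← expand_f two_ne_zero (k := 3) three_pos, rescale_neg_one_expand_two]
  have n1 := rescale_neg_one_f (k := 1) (by decide)
  have n3 := congrArg (expand 3 three_ne_zero) (rescale_neg_one_f (k := 3) (by decide))
  simp only [map_mul, map_pow, r2, r6] at e1 e2 e3 e4 n1 n3
  norm_num only at n1 n3
  rw [expand_f _ one_pos, expand_f _ two_pos] at e1
  rw [expand_f _ three_pos, expand_f _ (by norm_num)] at e3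
  rw [expand_f _ (by norm_num)] at e4
  rw [expand_f _ three_pos, expand_f _ (by norm_num), expand_f _ (by norm_num)] at n3
  norm_num only at e1 e3 e4 n3
  have hS := schurSeries_mul
  set r1 := rescale (-1) (f 1)
  set r9 := expand 3 three_ne_zero (rescale (-1) (f 3))
  set E := expand 2 two_ne_zero (theta 1 0)
  set W := expand 6 (by norm_num) (theta 3 0)
  set T := rescale (-1) (theta 1 0)
  set S := expand 3 three_ne_zero (rescale (-1) (theta 3 0))
  have hS0 : S ≠ 0 := ((isUnit_theta_three_zero.map (rescale (-1))).map
    (expand 3 three_ne_zero : ℤ⟦X⟧ →ₐ[ℤ] ℤ⟦X⟧)).ne_zero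
  have hW0 : W ≠ 0 := (isUnit_theta_three_zero.map
    (expand 6 (by norm_num) : ℤ⟦X⟧ →ₐ[ℤ] ℤ⟦X⟧)).ne_zero
  -- With E = φ(-q²), S = φ(q⁹), T = φ(q), W = φ(-q¹⁸), this is the eta quotient rewritten in theta
  -- functions.
  have key : schurSeries * E * S = T * W := by
    have g1 := f_ne_zero (k := 1) (by norm_num)
    have g2 := f_ne_zero (k := 2) (by norm_num)
    have g4 := f_ne_zero (k := 4) (by norm_num)
    have g9 := f_ne_zero (k := 9) (by norm_num)
    have g18 := f_ne_zero (k := 18) (by norm_num)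
    have g36 := f_ne_zero (k := 36) (by norm_num)
    have hT : T * f 1 ^ 2 * f 4 ^ 2 = f 2 ^ 5 := by
      refine mul_right_cancel₀ g2 ?_
      linear_combination f 1 ^ 2 * f 4 ^ 2 * e2 + (r1 * f 1 * f 4 + f 2 ^ 3) * n1
    have hS' : S * f 9 ^ 2 * f 36 ^ 2 = f 18 ^ 5 := by
      refine mul_right_cancel₀ g18 ?_
      linear_combination f 9 ^ 2 * f 36 ^ 2 * e4 + (r9 * f 9 * f 36 + f 18 ^ 3) * n3
    have g : f 1 ^ 2 * f 4 ^ 2 * f 18 ^ 3 * f 9 ^ 2 * f 36 ^ 2 ≠ 0 := by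
      simp [g1, g4, g9, g18, g36]
    refine mul_right_cancel₀ g ?_
    linear_combination E * f 4 * S * f 9 ^ 2 * f 36 ^ 2 * hS +
      f 2 ^ 3 * f 9 ^ 2 * f 36 * S * f 9 ^ 2 * f 36 ^ 2 * e1 +
      f 2 ^ 5 * f 9 ^ 2 * f 36 * hS' - W * f 18 ^ 3 * f 9 ^ 2 * f 36 ^ 2 * hT -
      f 2 ^ 5 * f 18 ^ 3 * f 9 ^ 2 * f 36 * e3
  refine mul_right_cancel₀ (mul_ne_zero hS0 hW0) ?_
  linear_combination key - schurSeries * S * hE + W * hR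

theorem schurSeries_dissection :
    schurSeries =
      expand 6 (by norm_num) (1 + 12 * X * (thetaRatio ^ 3 * invCubic)) +
      X ^ 1 * expand 6 (by norm_num) (2 * (evenPart * invCubic)) +
      X ^ 2 * expand 6 (by norm_num) (thetaRatio * invCubic + thetaRatio +
        16 * X * (thetaRatio ^ 4 * invCubic)) +
      X ^ 3 * expand 6 (by norm_num) (4 * (evenPart * thetaRatio * invCubic)) +
      X ^ 4 * expand 6 (by norm_num) (6 * (thetaRatio ^ 2 * invCubic)) +
      X ^ 5 * expand 6 (by norm_num) (8 * (evenPart * thetaRatio ^ 2 * invCubic)) := by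
  have h := schurSeries_eq
  have hd := congrArg (expand 6 (by norm_num)) invCubic_mul_eq_one
  simp only [map_mul, map_sub, map_add, map_pow, map_one, map_ofNat, expand_X] at hd ⊢
  generalize expand 6 _ thetaRatio = b at *
  generalize expand 6 _ evenPart = a at *
  generalize expand 6 _ invCubic = d at *
  -- The factor 1 + 2X²b + 4X⁴b² rationalizes the denominator 1 - 2X²b. The last term, through d(1 -
  -- 8X⁶b³) = 1, rewrites d(1 + 4X⁶b³) as 1 + 12X⁶b³d and 2bd + 8X⁶b⁴d as bd + b + 16X⁶b⁴d.
  linear_combination d * (1 + 2 * X ^ 2 * b + 4 * X ^ 4 * b ^ 2) * h -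
    schurSeries * hd + (1 + X ^ 2 * b) * hd

/-! ### Reading off residue classes; calculus of quotients -/

theorem coeff_six_mul_add_expand (p : ℤ⟦X⟧) {r s : ℕ} (hr : r < 6) (hs : s < 6) (n : ℕ) :
    coeff (6 * n + r) (X ^ s * expand 6 (by norm_num) p) = if s = r then coeff n p else 0 := by
  rw [coeff_X_pow_mul']
  split_ifs with h1 h2 h2
  · subst h2
    rw [Nat.add_sub_cancel, coeff_expand_mul]
  · exact coeff_expand_of_not_dvd _ _ _ (by omega)
  · omega
  · rfl

theorem mk_eq_of_six_dissection {c : ℕ → ℕ} {p : Fin 6 → ℤ⟦X⟧}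
    (h : (PowerSeries.mk fun n => (c n : ℤ)) =
      ∑ s : Fin 6, X ^ (s : ℕ) * expand 6 (by norm_num) (p s)) (r : Fin 6) :
    (PowerSeries.mk fun n => (c (6 * n + r) : ℤ)) = p r := by
  ext n
  have := congrArg (coeff (6 * n + r)) h
  rw [coeff_mk, map_sum] at this
  simp_rw [coeff_six_mul_add_expand _ r.isLt (Fin.isLt _), Fin.val_inj] at this
  rw [coeff_mk, this, Finset.sum_ite_eq' Finset.univ r, if_pos (Finset.mem_univ _)]

theorem eq_quot_of_mul_eq {x a b : ℤ⟦X⟧} (hb : IsUnit b) (h : x * b = a) : x = quot a b :=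
  hb.mul_right_cancel (h.trans (quot_mul_cancel a hb).symm)

theorem modEq_zero_of_mk_eq {c : ℕ → ℕ} {m : ℕ} {p : ℤ⟦X⟧}
    (h : (PowerSeries.mk fun n => (c n : ℤ)) = C (m : ℤ) * p) (n : ℕ) : c n ≡ 0 [MOD m] := by
  rw [Nat.modEq_zero_iff_dvd, ← Int.natCast_dvd_natCast]
  have := congrArg (coeff n) h
  rw [coeff_mk, coeff_C_mul] at this
  exact ⟨_, this⟩

theorem quot_mul_quot {a b c d : ℤ⟦X⟧} (hb : IsUnit b) (hd : IsUnit d) :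
    quot a b * quot c d = quot (a * c) (b * d) := by
  refine eq_quot_of_mul_eq (hb.mul hd) ?_
  linear_combination quot c d * d * quot_mul_cancel a hb + a * quot_mul_cancel c hd

theorem quot_pow {a b : ℤ⟦X⟧} (hb : IsUnit b) (n : ℕ) : quot a b ^ n = quot (a ^ n) (b ^ n) :=
  eq_quot_of_mul_eq (hb.pow n) (by rw [← mul_pow, quot_mul_cancel a hb])

theorem quot_eq_quot {a b c d : ℤ⟦X⟧} (hb : IsUnit b) (hd : IsUnit d) (h : a * d = c * b) :
    quot a b = quot c d := by
  refine eq_quot_of_mul_eq hd (hb.mul_right_cancel ?_)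
  linear_combination d * quot_mul_cancel a hb + h

end SchurOverpartition

open SchurOverpartition PowerSeries in
theorem mainTheorem10 :
    -- exact generating functions
    (PowerSeries.mk fun n => (numSchur 9 (6 * n) : ℤ)) =
        1 + 12 * X * quot (f 2 * f 6 ^ 5) (f 1 ^ 5 * f 3) ∧
    (PowerSeries.mk fun n => (numSchur 9 (6 * n + 1) : ℤ)) =
        2 * quot (f 2 ^ 6 * f 3 ^ 4) (f 1 ^ 8 * f 6 ^ 2) ∧
    (PowerSeries.mk fun n => (numSchur 9 (6 * n + 2) : ℤ)) =
        quot (f 2 ^ 3 * f 3 ^ 5) (f 1 ^ 7 * f 6) + quot (f 1 * f 6 ^ 3) (f 2 * f 3 ^ 3) +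
          16 * X * quot (f 6 ^ 8) (f 1 ^ 4 * f 3 ^ 4) ∧
    (PowerSeries.mk fun n => (numSchur 9 (6 * n + 3) : ℤ)) =
        4 * quot (f 2 ^ 5 * f 3 * f 6) (f 1 ^ 7) ∧
    (PowerSeries.mk fun n => (numSchur 9 (6 * n + 4) : ℤ)) =
        6 * quot (f 2 ^ 2 * f 3 ^ 2 * f 6 ^ 2) (f 1 ^ 6) ∧
    (PowerSeries.mk fun n => (numSchur 9 (6 * n + 5) : ℤ)) =
        8 * quot (f 2 ^ 4 * f 6 ^ 4) (f 1 ^ 6 * f 3 ^ 2) ∧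
    -- the resulting congruences
    (∀ n : ℕ, numSchur 9 (6 * n + 3) ≡ 0 [MOD 4]) ∧
    (∀ n : ℕ, numSchur 9 (6 * n + 4) ≡ 0 [MOD 6]) ∧
    (∀ n : ℕ, numSchur 9 (6 * n + 5) ≡ 0 [MOD 8]) ∧
    (∀ n : ℕ, numSchur 9 (6 * n + 6) ≡ 0 [MOD 12]) := by
  have u1 : IsUnit (f 1) := isUnit_f one_pos
  have u2 : IsUnit (f 2) := isUnit_f two_pos
  have u3 : IsUnit (f 3) := isUnit_f three_pos
  have u6 : IsUnit (f 6) := isUnit_f (by norm_num)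
  have v1 (n : ℕ) : IsUnit (f 1 ^ n) := u1.pow n
  have v2 (n : ℕ) : IsUnit (f 2 ^ n) := u2.pow n
  have v3 (n : ℕ) : IsUnit (f 3 ^ n) := u3.pow n
  have v6 (n : ℕ) : IsUnit (f 6 ^ n) := u6.pow n
  have uB : IsUnit (f 2 * f 3 ^ 3) := u2.mul (v3 3)
  have uD : IsUnit (f 1 ^ 8 * f 6 ^ 4) := (v1 8).mul (v6 4)
  have q0 : thetaRatio ^ 3 * invCubic = quot (f 2 * f 6 ^ 5) (f 1 ^ 5 * f 3) := by
    rw [thetaRatio, invCubic, quot_pow uB, quot_mul_quot (uB.pow 3) uD]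
    exact quot_eq_quot ((uB.pow 3).mul uD) ((v1 5).mul u3) (by ring)
  have q1 : evenPart * invCubic = quot (f 2 ^ 6 * f 3 ^ 4) (f 1 ^ 8 * f 6 ^ 2) := by
    rw [evenPart, invCubic, quot_mul_quot (v3 4) uD]
    exact quot_eq_quot ((v3 4).mul uD) ((v1 8).mul (v6 2)) (by ring)
  have q2 : thetaRatio * invCubic = quot (f 2 ^ 3 * f 3 ^ 5) (f 1 ^ 7 * f 6) := by
    rw [thetaRatio, invCubic, quot_mul_quot uB uD]
    exact quot_eq_quot (uB.mul uD) ((v1 7).mul u6) (by ring)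
  have q2' : thetaRatio ^ 4 * invCubic = quot (f 6 ^ 8) (f 1 ^ 4 * f 3 ^ 4) := by
    rw [thetaRatio, invCubic, quot_pow uB, quot_mul_quot (uB.pow 4) uD]
    exact quot_eq_quot ((uB.pow 4).mul uD) ((v1 4).mul (v3 4)) (by ring)
  have q3 : evenPart * thetaRatio * invCubic = quot (f 2 ^ 5 * f 3 * f 6) (f 1 ^ 7) := by
    rw [evenPart, thetaRatio, invCubic, quot_mul_quot (v3 4) uB,
      quot_mul_quot ((v3 4).mul uB) uD]
    exact quot_eq_quot (((v3 4).mul uB).mul uD) (v1 7) (by ring)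
  have q4 : thetaRatio ^ 2 * invCubic = quot (f 2 ^ 2 * f 3 ^ 2 * f 6 ^ 2) (f 1 ^ 6) := by
    rw [thetaRatio, invCubic, quot_pow uB, quot_mul_quot (uB.pow 2) uD]
    exact quot_eq_quot ((uB.pow 2).mul uD) (v1 6) (by ring)
  have q5 : evenPart * thetaRatio ^ 2 * invCubic = quot (f 2 ^ 4 * f 6 ^ 4) (f 1 ^ 6 * f 3 ^ 2) := by
    rw [evenPart, thetaRatio, invCubic, quot_pow uB, quot_mul_quot (v3 4) (uB.pow 2),
      quot_mul_quot ((v3 4).mul (uB.pow 2)) uD]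
    exact quot_eq_quot (((v3 4).mul (uB.pow 2)).mul uD) ((v1 6).mul (v3 2)) (by ring)
  have h := schurSeries_dissection
  rw [q0, q1, q2, q2', q3, q4, q5] at h
  have h' := mk_eq_of_six_dissection (c := numSchur 9)
    (p := ![1 + 12 * X * quot (f 2 * f 6 ^ 5) (f 1 ^ 5 * f 3),
      2 * quot (f 2 ^ 6 * f 3 ^ 4) (f 1 ^ 8 * f 6 ^ 2),
      quot (f 2 ^ 3 * f 3 ^ 5) (f 1 ^ 7 * f 6) + thetaRatio +
        16 * X * quot (f 6 ^ 8) (f 1 ^ 4 * f 3 ^ 4),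
      4 * quot (f 2 ^ 5 * f 3 * f 6) (f 1 ^ 7),
      6 * quot (f 2 ^ 2 * f 3 ^ 2 * f 6 ^ 2) (f 1 ^ 6),
      8 * quot (f 2 ^ 4 * f 6 ^ 4) (f 1 ^ 6 * f 3 ^ 2)])
    -- The term of index 0 needs an explicit factor 1 to match X ^ 0.
    (by rw [Fin.sum_univ_six]; refine Eq.trans h ?_; rw [← one_mul (expand 6 _ (1 + _))]; rfl)
  have h0 := h' 0
  have h3 := h' 3
  have h4 := h' 4
  have h5 := h' 5
  refine ⟨h0, h' 1, h' 2, h3, h4, h5, modEq_zero_of_mk_eq h3, modEq_zero_of_mk_eq h4,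
    modEq_zero_of_mk_eq h5, fun n => ?_⟩
  -- Since 6n + 6 = 6(n + 1), the coefficient of index n + 1 is taken; there the constant term 1 of
  -- the first series no longer contributes.
  have hn := congrArg (coeff (n + 1)) h0
  have e : (12 * X * quot (f 2 * f 6 ^ 5) (f 1 ^ 5 * f 3) : ℤ⟦X⟧) =
      X * (C (12 : ℤ) * quot (f 2 * f 6 ^ 5) (f 1 ^ 5 * f 3)) := by
    rw [map_ofNat]; ring
  simp only [Matrix.cons_val_zero] at hn
  rw [coeff_mk, e, map_add, coeff_succ_X_mul, coeff_C_mul, coeff_one, if_neg (Nat.succ_ne_zero n),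
    zero_add] at hn
  rw [Nat.modEq_zero_iff_dvd, ← Int.natCast_dvd_natCast]
  exact ⟨_, hn⟩
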